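/- Let $k$ be a ($\mathbb{Z}$-)graded commutative ring, i.e. $xy=(-1)^{|x||y|}yx$ for homogeneous elements, and let $\mathrm{Alg}_k$ be the category of graded commutative unital $k$-algebras. A *formal scheme* over $k$ is a functor $X\colon \mathrm{Alg}_k\to\mathrm{Set}$ that is a small filtered colimit of representable functors; a functor from $\mathrm{Alg}_k$ to $\mathbb{Z}$-graded sets is a (graded) formal scheme if each of its homogeneous components is a formal scheme. A *formal $k$-algebra scheme* over $k$ is a functor $F\colon \mathrm{Alg}_k\to\mathrm{Alg}_k$ whose underlying functor to $\mathbb{Z}$-graded sets is a formal scheme. Let $\mathrm{Sch}_k$ and $\mathrm{fAlgSch}_k^k$ denote the categories of formal schemes and of formal $k$-algebra schemes over $k$, with natural transformations as morphisms. Then: 1. $\mathrm{fAlgSch}_k^k$ has all small limits and all small colimits. 2. $\mathrm{fAlgSch}_k^k$ has a monoidal structure $\circ$ given by composition of functors, $(F\circ G)(T)=F(G(T))$, with the identity functor as unit; that is, the inclusion of $\mathrm{fAlgSch}_k^k$ into the category of all endofunctors of $\mathrm{Alg}_k$ with composition is a strong monoidal functor. 3. The monoidal category $(\mathrm{fAlgSch}_k^k,\circ,\mathrm{id})$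 acts from the right on $\mathrm{Sch}_k$ by composition of functors, $(X\circ F)(T)=X(F(T))$, compatibly with the associativity and unit isomorphisms of composition. The same holds for graded formal schemes. -/

import Mathlib

open CategoryTheory MonoidalCategory Limits

universe v₁ v₂ u₁ u₂ u

namespace FormalPlethory

/-- A graded commutative ring: a `ℤ`-indexed family of abelian groups `A p` with a unit in degree
`0` and biadditive, associative, unital multiplications `A p × A q → A (p + q)` satisfying the
sign rule `x y = (-1) ^ (p q) y x`. To avoid transports between `A r` and `A r'` for equal
integers `r`, `r'`, the multiplication takes values in `A r` for any `r` with `p + q = r`. -/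
structure GrCommRing where
  /-- the homogeneous elements of a given degree -/
  carrier : ℤ → Type u
  [addCommGroup : ∀ p, AddCommGroup (carrier p)]
  one : carrier 0
  mul {p q r : ℤ} (h : p + q = r) : carrier p →+ carrier q →+ carrier r
  one_mul {p : ℤ} (x : carrier p) : mul (zero_add p) one x = x
  mul_one {p : ℤ} (x : carrier p) : mul (add_zero p) x one = x
  mul_assoc {p q r s t w : ℤ} (hs : p + q = s) (ht : q + r = t) (hw : s + r = w) (hw' : p + t = w)
    (x : carrier p) (y : carrier q) (z : carrier r) :
    mul hw (mul hs x y) z = mul hw' x (mul ht y z)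
  mul_comm {p q r : ℤ} (h : p + q = r) (h' : q + p = r) (x : carrier p) (y : carrier q) :
    mul h x y = (p * q).negOnePow • mul h' y x

namespace GrCommRing

attribute [instance] addCommGroup

/-- Degree-preserving unital ring homomorphisms. -/
@[ext]
structure Hom (A B : GrCommRing.{u}) where
  toFun (p : ℤ) : A.carrier p →+ B.carrier p
  map_one : toFun 0 A.one = B.one
  map_mul {p q r : ℤ} (h : p + q = r) (x : A.carrier p) (y : A.carrier q) :
    toFun r (A.mul h x y) = B.mul h (toFun p x) (toFun q y)

instance : Category GrCommRing.{u} where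
  Hom := Hom
  id A := { toFun := fun _ => AddMonoidHom.id _, map_one := rfl, map_mul := fun _ _ _ => rfl }
  comp f g :=
    { toFun := fun p => (g.toFun p).comp (f.toFun p)
      map_one := by simp [f.map_one, g.map_one]
      map_mul := fun h x y => by simp [f.map_mul, g.map_mul] }

/-- The functor sending a graded ring to its set of elements of degree `p`. -/
def degree (p : ℤ) : GrCommRing.{u} ⥤ Type u where
  obj A := A.carrier p
  map f := TypeCat.ofHom fun x => Hom.toFun f p x

/-- The functor sending a graded ring to its underlying graded set. -/
def toGradedSet : GrCommRing.{u} ⥤ (ℤ → Type u) :=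
  Functor.pi' degree

end GrCommRing

/-- The category of graded commutative unital `k`-algebras: graded commutative rings `A` with a
homomorphism of graded rings `k ⟶ A`. -/
abbrev GrAlg (k : GrCommRing.{u}) : Type (u + 1) := Under k

/-- The underlying graded set of a graded `k`-algebra. -/
def GrAlg.toGradedSet (k : GrCommRing.{u}) : GrAlg k ⥤ (ℤ → Type u) :=
  Under.forget k ⋙ GrCommRing.toGradedSet

/-- A functor from graded `k`-algebras to sets is a formal scheme over `k` if it is a small
filtered colimit of (covariantly) representable functors, i.e. an ind-object of `(GrAlg k)ᵒᵖ`. -/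
def isFormalScheme (k : GrCommRing.{u}) : ObjectProperty (GrAlg k ⥤ Type u) :=
  fun X => IsIndObject (C := (GrAlg k)ᵒᵖ) (unopUnop (GrAlg k) ⋙ X)

/-- The graded version: a functor to graded sets each of whose components is a formal scheme. -/
def isGradedFormalScheme (k : GrCommRing.{u}) : ObjectProperty (GrAlg k ⥤ (ℤ → Type u)) :=
  fun X => ∀ p : ℤ, isFormalScheme k (X ⋙ Pi.eval _ p)

/-- A functor from graded `k`-algebras to graded `k`-algebras is a formal `k`-algebra scheme over
`k` if its underlying functor to graded sets is a formal scheme. -/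
def isFormalAlgebraScheme (k : GrCommRing.{u}) : ObjectProperty (GrAlg k ⥤ GrAlg k) :=
  fun F => isGradedFormalScheme k (F ⋙ GrAlg.toGradedSet k)

/-- The category of (set-valued) formal schemes over `k`; morphisms are natural transformations. -/
abbrev FSch (k : GrCommRing.{u}) := (isFormalScheme k).FullSubcategory

/-- The category of graded-set-valued formal schemes over `k`. -/
abbrev GrFSch (k : GrCommRing.{u}) := (isGradedFormalScheme k).FullSubcategory

/-- The category of formal `k`-algebra schemes over `k`; morphisms are natural transformations of
functors with values in graded `k`-algebras. -/
abbrev FAlgSch (k : GrCommRing.{u}) := (isFormalAlgebraScheme k).FullSubcategory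

section Composition

attribute [local instance] endofunctorMonoidalCategory

variable {A : Type u₁} [Category.{v₁} A] {D : Type u₂} [Category.{v₂} D]

/-- The inclusion of a full subcategory `P` of the category of endofunctors of `A` into all
endofunctors. The target carries the monoidal structure `F ∘ G` (first `G`, then `F`) with unit
the identity functor; Mathlib's convention for endofunctors is `F ⊗ G = F ⋙ G` (first `F`, then
`G`), hence the monoidal opposite. -/
def toEndofunctors (P : ObjectProperty (A ⥤ A)) : P.FullSubcategory ⥤ (A ⥤ A)ᴹᵒᵖ :=
  P.ι ⋙ mopFunctor (A ⥤ A)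

/-- A monoidal structure on a full subcategory `P` of endofunctors is given by composition of
functors if the inclusion into all endofunctors is a (strong) monoidal functor: there are
isomorphisms `F ⊗ G ≅ F ∘ G` and `𝟙_ ≅ 𝟭` that are natural and compatible with the associators
and unitors. -/
abbrev TensorIsComposition (P : ObjectProperty (A ⥤ A)) [MonoidalCategory P.FullSubcategory] :=
  (toEndofunctors P).Monoidal

/-- The comparison `F ⊗ G ≅ F ∘ G`. -/
def tensorIsoComp (P : ObjectProperty (A ⥤ A)) [MonoidalCategory P.FullSubcategory]
    [TensorIsComposition P] (F G : P.FullSubcategory) : (F ⊗ G).obj ≅ G.obj ⋙ F.obj where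
  hom := (Functor.OplaxMonoidal.δ (toEndofunctors P) F G).unmop
  inv := (Functor.LaxMonoidal.μ (toEndofunctors P) F G).unmop
  hom_inv_id := congrArg Quiver.Hom.unmop (Functor.Monoidal.δ_μ (toEndofunctors P) F G)
  inv_hom_id := congrArg Quiver.Hom.unmop (Functor.Monoidal.μ_δ (toEndofunctors P) F G)

/-- The comparison between the unit object and the identity functor. -/
def unitIsoId (P : ObjectProperty (A ⥤ A)) [MonoidalCategory P.FullSubcategory]
    [TensorIsComposition P] : (𝟙_ P.FullSubcategory).obj ≅ 𝟭 A where
  hom := (Functor.OplaxMonoidal.η (toEndofunctors P)).unmop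
  inv := (Functor.LaxMonoidal.ε (toEndofunctors P)).unmop
  hom_inv_id := congrArg Quiver.Hom.unmop (Functor.Monoidal.η_ε (toEndofunctors P))
  inv_hom_id := congrArg Quiver.Hom.unmop (Functor.Monoidal.ε_η (toEndofunctors P))

open scoped MonoidalRightAction in
/-- Let `P` be a full subcategory of endofunctors of `A`, monoidal under composition, acting from
the right on a full subcategory `Q` of functors `A ⥤ D`. The action is given by composition if
there are isomorphisms `X ⊙ᵣ F ≅ X ∘ F`, natural in both variables, under which the associator
`X ⊙ᵣ (F ⊗ G) ≅ (X ⊙ᵣ F) ⊙ᵣ G` and the unitor `X ⊙ᵣ 𝟙_ ≅ X` of the action become the identities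
`X ∘ (F ∘ G) = (X ∘ F) ∘ G` and `X ∘ 𝟭 = X`. -/
structure ActionIsComposition (P : ObjectProperty (A ⥤ A)) (Q : ObjectProperty (A ⥤ D))
    [MonoidalCategory P.FullSubcategory] [TensorIsComposition P]
    [MonoidalRightAction P.FullSubcategory Q.FullSubcategory] where
  iso (X : Q.FullSubcategory) (F : P.FullSubcategory) : (X ⊙ᵣ F).obj ≅ F.obj ⋙ X.obj
  naturality_left {X Y : Q.FullSubcategory} (f : X ⟶ Y) (F : P.FullSubcategory) :
    (f ⊵ᵣ F).hom ≫ (iso Y F).hom = (iso X F).hom ≫ Functor.whiskerLeft F.obj f.hom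
  naturality_right (X : Q.FullSubcategory) {F G : P.FullSubcategory} (g : F ⟶ G) :
    (X ⊴ᵣ g).hom ≫ (iso X G).hom = (iso X F).hom ≫ Functor.whiskerRight g.hom X.obj
  associativity (X : Q.FullSubcategory) (F G : P.FullSubcategory) :
    (αᵣ X F G).hom.hom ≫ (iso (X ⊙ᵣ F) G).hom ≫ Functor.whiskerLeft G.obj (iso X F).hom =
      (iso X (F ⊗ G)).hom ≫ Functor.whiskerRight (tensorIsoComp P F G).hom X.obj ≫
        (Functor.associator G.obj F.obj X.obj).hom
  unitality (X : Q.FullSubcategory) :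
    (ρᵣ[P.FullSubcategory] X).hom.hom =
      (iso X (𝟙_ P.FullSubcategory)).hom ≫ Functor.whiskerRight (unitIsoId P).hom X.obj ≫
        (Functor.leftUnitor X.obj).hom

end Composition

end FormalPlethory

/-! Everything rests on an intrinsic description of formal schemes, `isFormalScheme_iff`: a functor
`X` to sets is one exactly when it preserves finite limits and, for some cardinal `κ`, each element
of each `X(T)` is the image of an element over an algebra of size at most `κ`. Left exactness makes
the category of elements filtered in the direction needed for an ind-object, and bounded support
makes it finally small.

Small algebras are available in abundance: for large `κ`, at most `κ` maps from `κ`-small algebras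
to `T` all factor through one `κ`-small subalgebra `R` of `T`, and a left exact functor embeds its
value at `R` into its value at `T`. So elements found separately over small algebras can be moved to
a common one, and identities between them can be checked over `T`. This shows that formal schemes
are stable under small limits and under precomposition with formal algebra schemes. The monoidal
structure and the actions are then restrictions of composition of functors, whose coherence
isomorphisms have identity components.

Colimits come from the general adjoint functor theorem. Limits exist, and a functor with support
bounded by `κ` is determined by its restriction to `κ`-small algebras, which form an essentially
small category, so hom-sets are small. For the solution set, let a cocone on `D` with vertex `H` be
given. Inside the restriction of `H` to `κ`-small algebras, close the images of the `D j` under the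
algebra operations, functoriality and unique lifts along jointly injective pairs
(`exists_small_subfunctor`). The closure has size bounded by some `μ` that does not depend on `H`.
It generates a subfunctor of `H` through which the cocone factors; closure under unique lifts makes
this subfunctor left exact (`preservesFiniteLimits_of_generated`). Only a set of isomorphism classes
of such subfunctors can occur. -/

namespace FormalPlethory

/-! ### Graded commutative rings: isomorphisms, subrings, limits -/

section

namespace GrCommRing

lemma hom_ext {A B : GrCommRing.{u}} {f g : A ⟶ B}
    (h : ∀ p x, Hom.toFun f p x = Hom.toFun g p x) : f = g :=
  Hom.ext (funext fun p => AddMonoidHom.ext (h p))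

/-- A degreewise bijective homomorphism is an isomorphism. -/
lemma isIso_of_bijective {A B : GrCommRing.{u}} (f : A ⟶ B)
    (hf : ∀ p, Function.Bijective (Hom.toFun f p)) : IsIso f := by
  let e (p : ℤ) : A.carrier p ≃+ B.carrier p := AddEquiv.ofBijective (Hom.toFun f p) (hf p)
  have he (p : ℤ) (x : B.carrier p) : Hom.toFun f p ((e p).symm x) = x :=
    (e p).apply_symm_apply x
  have he' (p : ℤ) (x : A.carrier p) : (e p).symm (Hom.toFun f p x) = x :=
    (e p).symm_apply_apply x
  let g : B ⟶ A :=
    { toFun := fun p => (e p).symm.toAddMonoidHom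
      map_one := (hf 0).1 ((he 0 _).trans (Hom.map_one f).symm)
      map_mul := fun {p q r} h x y => (hf r).1 ((he r _).trans (by
        rw [Hom.map_mul f]
        exact congr_arg₂ (fun a b => B.mul h a b) (he p x).symm (he q y).symm)) }
  exact ⟨g, hom_ext he', hom_ext he⟩

/-- The functors `degree p` jointly reflect isomorphisms. -/
lemma jointlyReflectIsomorphisms_degree :
    JointlyReflectIsomorphisms (fun p : ℤ => degree.{u} p) where
  isIso f _ := isIso_of_bijective f fun p => (isIso_iff_bijective ((degree p).map f)).1 inferInstance

/-- A graded subring. -/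
structure Sub (A : GrCommRing.{u}) where
  /-- the homogeneous elements of a given degree -/
  carrier (p : ℤ) : AddSubgroup (A.carrier p)
  one_mem : A.one ∈ carrier 0
  mul_mem {p q r : ℤ} (h : p + q = r) {x : A.carrier p} {y : A.carrier q} :
    x ∈ carrier p → y ∈ carrier q → A.mul h x y ∈ carrier r

namespace Sub

variable {A : GrCommRing.{u}} (S : Sub A)

/-- A graded subring as a graded ring. -/
def toGrCommRing : GrCommRing.{u} where
  carrier p := S.carrier p
  one := ⟨A.one, S.one_mem⟩
  mul {p q r} h := AddMonoidHom.mk' (fun x => AddMonoidHom.mk'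
    (fun y => ⟨A.mul h x.1 y.1, S.mul_mem h x.2 y.2⟩) fun _ _ => Subtype.ext (by simp))
    fun _ _ => AddMonoidHom.ext fun _ => Subtype.ext (by simp)
  one_mul x := Subtype.ext (A.one_mul x.1)
  mul_one x := Subtype.ext (A.mul_one x.1)
  mul_assoc hs ht hw hw' x y z := Subtype.ext (A.mul_assoc hs ht hw hw' x.1 y.1 z.1)
  mul_comm h h' x y := Subtype.ext (A.mul_comm h h' x.1 y.1)

/-- The inclusion of a graded subring. -/
def ι : S.toGrCommRing ⟶ A where
  toFun p := (S.carrier p).subtype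
  map_one := rfl
  map_mul _ _ _ := rfl

/-- Corestriction of a homomorphism to a graded subring. -/
def lift {B : GrCommRing.{u}} (f : B ⟶ A) (hf : ∀ p x, Hom.toFun f p x ∈ S.carrier p) :
    B ⟶ S.toGrCommRing where
  toFun p := (Hom.toFun f p).codRestrict (S.carrier p) (hf p)
  map_one := Subtype.ext (Hom.map_one f)
  map_mul h x y := Subtype.ext (Hom.map_mul f h x y)

end Sub

section Limits

variable {J : Type u} [SmallCategory J] (F : J ⥤ GrCommRing.{u})

/-- The product of a family of graded rings. -/
def piObj {J : Type u} (A : J → GrCommRing.{u}) : GrCommRing.{u} where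
  carrier p := ∀ j, (A j).carrier p
  one j := (A j).one
  mul h := AddMonoidHom.mk' (fun x => AddMonoidHom.mk' (fun y j => (A j).mul h (x j) (y j))
    fun _ _ => funext fun _ => by simp) fun _ _ => AddMonoidHom.ext fun _ => funext fun _ => by simp
  one_mul x := funext fun j => (A j).one_mul (x j)
  mul_one x := funext fun j => (A j).mul_one (x j)
  mul_assoc hs ht hw hw' x y z := funext fun j => (A j).mul_assoc hs ht hw hw' (x j) (y j) (z j)
  mul_comm h h' x y := funext fun j => (A j).mul_comm h h' (x j) (y j)

/-- The graded subring of sections in the product of a diagram of graded rings. -/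
def sectionsSub : Sub (piObj F.obj) where
  carrier p :=
    { carrier := {x | ∀ ⦃i j : J⦄ (f : i ⟶ j), Hom.toFun (F.map f) p (x i) = x j}
      add_mem' := fun hx hy _ _ f => ((Hom.toFun (F.map f) p).map_add _ _).trans
        (congr_arg₂ (· + ·) (hx f) (hy f))
      zero_mem' := fun _ _ f => (Hom.toFun (F.map f) p).map_zero
      neg_mem' := fun hx _ _ f => ((Hom.toFun (F.map f) p).map_neg _).trans
        (congr_arg (- ·) (hx f)) }
  one_mem _ _ f := Hom.map_one (F.map f)
  mul_mem h _ _ hx hy _ j f := (Hom.map_mul (F.map f) h _ _).trans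
    (congr_arg₂ (fun a b => (F.obj j).mul h a b) (hx f) (hy f))

/-- The limit cone of a diagram of graded rings. -/
def limitCone : Cone F where
  pt := (sectionsSub F).toGrCommRing
  π :=
    { app := fun j =>
        { toFun := fun p => (Pi.evalAddMonoidHom (fun j => (F.obj j).carrier p) j).comp
            ((sectionsSub F).carrier p).subtype
          map_one := rfl
          map_mul := fun _ _ _ => rfl }
      naturality := fun _ _ f => hom_ext fun _ x => (x.2 f).symm }

/-- The limit cone of a diagram of graded rings is a limit cone. -/
def limitConeIsLimit : IsLimit (limitCone F) where
  lift s :=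
    { toFun := fun p => (AddMonoidHom.pi fun j => Hom.toFun (s.π.app j) p).codRestrict
        ((sectionsSub F).carrier p)
        fun x _ _ f => congr_arg (fun g : s.pt ⟶ _ => Hom.toFun g p x) (s.w f)
      map_one := Subtype.ext (funext fun j => Hom.map_one (s.π.app j))
      map_mul := fun h x y => Subtype.ext (funext fun j => Hom.map_mul (s.π.app j) h x y) }
  fac _ _ := rfl
  uniq s _ hm := hom_ext fun p x => Subtype.ext (funext fun j =>
    congr_arg (fun g : s.pt ⟶ F.obj j => Hom.toFun g p x) (hm j))

instance : HasLimits GrCommRing.{u} where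
  has_limits_of_shape _ _ := { has_limit := fun F => ⟨⟨_, limitConeIsLimit F⟩⟩ }

instance (p : ℤ) : PreservesLimits (degree.{u} p) where
  preservesLimitsOfShape := ⟨fun {F} => preservesLimit_of_preserves_limit_cone (limitConeIsLimit F)
    ((Types.isLimit_iff _).2 fun s hs =>
      ⟨(⟨s, fun _ _ f => hs f⟩ : (sectionsSub F).carrier p), fun _ => rfl,
        fun _ hy => Subtype.ext (funext hy)⟩).some⟩

end Limits

end GrCommRing

end

/-! ### Graded algebras and subfunctors of algebra-valued functors -/

section

variable {k : GrCommRing.{u}}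

namespace GrAlg

/-- The functor sending a graded `k`-algebra to its set of elements of degree `p`. -/
abbrev degree (k : GrCommRing.{u}) (p : ℤ) : GrAlg k ⥤ Type u :=
  Under.forget k ⋙ GrCommRing.degree p

/-- The map in degree `p` underlying a homomorphism of graded algebras. -/
def app {S T : GrAlg k} (f : S ⟶ T) (p : ℤ) : S.right.carrier p →+ T.right.carrier p :=
  GrCommRing.Hom.toFun f.right p

@[simp]
lemma comp_app {S T U : GrAlg k} (f : S ⟶ T) (g : T ⟶ U) (p : ℤ) (x : S.right.carrier p) :
    app (f ≫ g) p x = app g p (app f p x) := rfl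

lemma hom_ext {S T : GrAlg k} {f g : S ⟶ T} (h : ∀ p x, app f p x = app g p x) : f = g :=
  Under.UnderMorphism.ext (GrCommRing.hom_ext h)

lemma map_mul {S T : GrAlg k} (f : S ⟶ T) {p q r : ℤ} (h : p + q = r) (x : S.right.carrier p)
    (y : S.right.carrier q) : app f r (S.right.mul h x y) = T.right.mul h (app f p x) (app f q y) :=
  GrCommRing.Hom.map_mul f.right h x y

lemma map_one {S T : GrAlg k} (f : S ⟶ T) : app f 0 S.right.one = T.right.one :=
  GrCommRing.Hom.map_one f.right

/-- The image of a scalar in a graded algebra. -/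
def scalar (T : GrAlg k) (p : ℤ) : k.carrier p →+ T.right.carrier p :=
  GrCommRing.Hom.toFun T.hom p

@[simp]
lemma app_scalar {S T : GrAlg k} (f : S ⟶ T) (p : ℤ) (c : k.carrier p) :
    app f p (scalar S p c) = scalar T p c :=
  congr_arg (fun g : k ⟶ T.right => GrCommRing.Hom.toFun g p c) (Under.w f)

lemma jointlyReflectIsomorphisms_degree :
    JointlyReflectIsomorphisms (fun p : ℤ => degree k p) where
  isIso {S T} f _ := by
    have (p : ℤ) : IsIso ((GrCommRing.degree p).map ((Under.forget k).map f)) :=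
      inferInstanceAs (IsIso ((degree k p).map f))
    have : IsIso ((Under.forget k).map f) :=
      GrCommRing.jointlyReflectIsomorphisms_degree.isIso _
    exact isIso_of_reflects_iso f (Under.forget k)

lemma mono_of_injective {S T : GrAlg k} (f : S ⟶ T) (hf : ∀ p, Function.Injective (app f p)) :
    Mono f where
  right_cancellation g h e := hom_ext fun p x => hf p (by rw [← comp_app, e, comp_app])

lemma injective_of_mono {S T : GrAlg k} (f : S ⟶ T) [Mono f] (p : ℤ) :
    Function.Injective (app f p) :=
  (mono_iff_injective ((degree k p).map f)).1 inferInstance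

/-- A functor to graded algebras preserves limits if it does so in each degree. -/
lemma preservesLimitsOfShape_of_degree {C : Type*} [Category* C] (F : C ⥤ GrAlg k)
    (J : Type u) [SmallCategory J] (h : ∀ p, PreservesLimitsOfShape J (F ⋙ degree k p)) :
    PreservesLimitsOfShape J F where
  preservesLimit := ⟨fun hc => ⟨jointlyReflectIsomorphisms_degree.jointlyReflectsLimit
    fun p => isLimitOfPreserves (F ⋙ degree k p) hc⟩⟩

lemma preservesFiniteLimits_of_degree {C : Type*} [Category* C] (F : C ⥤ GrAlg k)
    (h : ∀ p, PreservesFiniteLimits (F ⋙ degree k p)) : PreservesFiniteLimits F :=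
  preservesFiniteLimits_of_preservesFiniteLimitsOfSize.{u} F fun J _ _ =>
    preservesLimitsOfShape_of_degree F J fun _ =>
      inferInstance

/-- The graded subalgebra with given homogeneous elements. -/
def ofSub (T : GrAlg k) (S : GrCommRing.Sub T.right) (hS : ∀ p c, scalar T p c ∈ S.carrier p) :
    GrAlg k :=
  Under.mk (S.lift T.hom hS)

/-- The inclusion of a graded subalgebra. -/
def ofSubι (T : GrAlg k) (S : GrCommRing.Sub T.right) (hS : ∀ p c, scalar T p c ∈ S.carrier p) :
    ofSub T S hS ⟶ T :=
  Under.homMk S.ι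

/-- Corestriction of a homomorphism of graded algebras along an injective one. -/
lemma exists_lift {R S T : GrAlg k} (m : S ⟶ T) (hm : ∀ p, Function.Injective (app m p))
    (f : R ⟶ T) (hf : ∀ p x, app f p x ∈ Set.range (app m p)) : ∃ g : R ⟶ S, g ≫ m = f := by
  choose g hg using hf
  exact ⟨Under.homMk
    { toFun := fun p => AddMonoidHom.mk' (g p) fun x y => hm p (by simp [hg])
      map_one := hm 0 (by simp [hg, map_one])
      map_mul := fun h x y => hm _ (by simp [hg, map_mul]) }
    (GrCommRing.hom_ext fun p c => hm p ((hg p _).trans (by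
      exact (app_scalar f p c).trans (app_scalar m p c).symm))), hom_ext hg⟩

/-- A family of graded subalgebras stable under a functor's action is a subfunctor. -/
lemma exists_subfunctor {C : Type*} [Category* C] (H : C ⥤ GrAlg k)
    (U : ∀ T, GrCommRing.Sub (H.obj T).right)
    (hU : ∀ T p c, scalar (H.obj T) p c ∈ (U T).carrier p)
    (hmap : ∀ {S T : C} (f : S ⟶ T) (p : ℤ), ∀ x ∈ (U S).carrier p,
      app (H.map f) p x ∈ (U T).carrier p) :
    ∃ (G : C ⥤ GrAlg k) (m : G ⟶ H), (∀ T p, Function.Injective (app (m.app T) p)) ∧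
      ∀ T p x, x ∈ Set.range (app (m.app T) p) ↔ x ∈ (U T).carrier p := by
  have hinj (T : C) (p : ℤ) : Function.Injective (app (ofSubι (H.obj T) (U T) (hU T)) p) :=
    Subtype.val_injective
  have hmono (T : C) := mono_of_injective _ (hinj T)
  choose r hr using fun {S T : C} (f : S ⟶ T) => exists_lift (ofSubι (H.obj T) (U T) (hU T))
    (hinj T) (ofSubι (H.obj S) (U S) (hU S) ≫ H.map f) fun p x => ⟨⟨_, hmap f p _ x.2⟩, rfl⟩
  refine ⟨{ obj := fun T => ofSub (H.obj T) (U T) (hU T)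
            map := r
            map_id := fun T => by rw [← cancel_mono (ofSubι (H.obj T) (U T) (hU T)), hr]; simp
            map_comp := fun {R S T} f g => by
              rw [← cancel_mono (ofSubι (H.obj T) (U T) (hU T)), hr, Category.assoc, hr,
                ← Category.assoc, hr]
              simp },
    { app := fun T => ofSubι (H.obj T) (U T) (hU T)
      naturality := fun _ _ f => hr f }, hinj, fun T p x => ⟨?_, fun h => ⟨⟨x, h⟩, rfl⟩⟩⟩
  rintro ⟨y, rfl⟩
  exact y.2

end GrAlg

end

/-! ### Cardinality bounds and small closed subfunctors -/

section

open Cardinal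

lemma mk_sigma_le {I : Type v₁} {κ : Cardinal.{u}} (hκ : ℵ₀ ≤ κ)
    (hI : lift.{u} #I ≤ lift.{v₁} κ) {f : I → Type u} (hf : ∀ i, #(f i) ≤ κ) :
    #(Σ i, f i) ≤ lift.{v₁} κ := by
  rw [mk_sigma]
  refine (sum_le_lift_mk_mul_iSup_lift _).trans ((mul_le_mul' hI (ciSup_le' fun i =>
    lift_le.2 (hf i))).trans_eq (mul_eq_self (by simpa using hκ)))

/-- A set of size at most `κ` is contained in a set of size at most `κ` that is closed under a
family of at most `κ` partial binary operations. -/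
lemma exists_closed_superset {Z N : Type u} {κ : Cardinal.{u}} (hκ : ℵ₀ ≤ κ) (hN : #N ≤ κ)
    (R : N → Z → Z → Z → Prop) (hR : ∀ n x y z z', R n x y z → R n x y z' → z = z')
    (S : Set Z) (hS : #S ≤ κ) :
    ∃ S' : Set Z, S ⊆ S' ∧ #S' ≤ κ ∧ ∀ n x y z, x ∈ S' → y ∈ S' → R n x y z → z ∈ S' := by
  let step (S : Set Z) : Set Z := S ∪ {z | ∃ n, ∃ x ∈ S, ∃ y ∈ S, R n x y z}
  have hstep (S : Set Z) (hS : #S ≤ κ) : #(step S) ≤ κ := by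
    refine (mk_union_le _ _).trans ((add_le_add hS ?_).trans_eq (add_eq_self hκ))
    have (z : {z | ∃ n, ∃ x ∈ S, ∃ y ∈ S, R n x y z}) :
        ∃ a : N × S × S, R a.1 a.2.1 a.2.2 z := by
      obtain ⟨z, n, x, hx, y, hy, h⟩ := z
      exact ⟨(n, ⟨x, hx⟩, ⟨y, hy⟩), h⟩
    choose a ha using this
    -- As the operations are single-valued, a new element is determined by the operation and the
    -- arguments producing it.
    refine (mk_le_of_injective (f := a) fun z z' h => Subtype.ext (hR _ _ _ _ _ (ha z) ?_)).trans ?_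
    · rw [h]
      exact ha z'
    · simp only [mk_prod, lift_id]
      exact (mul_le_mul' hN (mul_le_mul' hS hS)).trans_eq (by rw [mul_eq_self hκ, mul_eq_self hκ])
  -- Since the operations are binary, countably many rounds suffice: two elements of the union
  -- already lie in a common stage.
  let T (n : ℕ) : Set Z := step^[n] S
  have hT (n : ℕ) : T (n + 1) = step (T n) := Function.iterate_succ_apply' step n S
  have hmono : Monotone T := monotone_nat_of_le_succ fun n => by
    rw [hT]
    exact Set.subset_union_left
  refine ⟨⋃ n, T n, Set.subset_iUnion T 0, ?_, ?_⟩
  · have hcard (n : ℕ) : #(T n) ≤ κ := by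
      induction n with
      | zero => exact hS
      | succ n ih => rw [hT]; exact hstep _ ih
    have := (mk_iUnion_le_lift T).trans
      (mul_le_mul' (a := lift.{u} #ℕ) (b := κ) (by simpa using hκ) (ciSup_le' (a := κ) (by simpa)))
    simpa [mul_eq_self hκ] using this
  · intro n x y z hx hy h
    obtain ⟨i, hi⟩ := Set.mem_iUnion.1 hx
    obtain ⟨j, hj⟩ := Set.mem_iUnion.1 hy
    refine Set.mem_iUnion.2 ⟨max i j + 1, ?_⟩
    rw [hT]
    exact Or.inr ⟨n, x, hmono (le_max_left i j) hi, y, hmono (le_max_right i j) hj, h⟩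

variable {k : GrCommRing.{u}}

/-- The property of graded algebras whose homogeneous components have cardinality at most `κ`. -/
def sizeLE (k : GrCommRing.{u}) (κ : Cardinal.{u}) : ObjectProperty (GrAlg k) :=
  fun T => ∀ p, #(T.right.carrier p) ≤ κ

section Subfunctor

variable {B : Type u} [SmallCategory B] (H : B ⥤ GrAlg k)

/-- Names for the operations under which a subfunctor of a functor to graded algebras is to be
closed. -/
inductive SubfunctorOp (B : Type u) [SmallCategory B] : Type u
  | add
  | neg
  | mul
  | map {b b' : B} (f : b ⟶ b')
  | lift {b b₁ b₂ : B} (f : b ⟶ b₁) (g : b ⟶ b₂)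

/-- The graphs of the operations named by `SubfunctorOp`; `lift f g` produces the unique common
preimage of two elements along `f` and `g` if these are jointly injective. -/
inductive SubfunctorRel : SubfunctorOp B → (Σ (b : B) (p : ℤ), (H.obj b).right.carrier p) →
    (Σ (b : B) (p : ℤ), (H.obj b).right.carrier p) →
    (Σ (b : B) (p : ℤ), (H.obj b).right.carrier p) → Prop
  | add {b : B} {p : ℤ} (x y : (H.obj b).right.carrier p) :
      SubfunctorRel .add ⟨b, p, x⟩ ⟨b, p, y⟩ ⟨b, p, x + y⟩
  -- Unary operations are encoded as binary ones defined on the diagonal.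
  | neg {b : B} {p : ℤ} (x : (H.obj b).right.carrier p) :
      SubfunctorRel .neg ⟨b, p, x⟩ ⟨b, p, x⟩ ⟨b, p, -x⟩
  | mul {b : B} {p q : ℤ} (x : (H.obj b).right.carrier p) (y : (H.obj b).right.carrier q) :
      SubfunctorRel .mul ⟨b, p, x⟩ ⟨b, q, y⟩ ⟨b, p + q, (H.obj b).right.mul rfl x y⟩
  | map {b b' : B} (f : b ⟶ b') {p : ℤ} (x : (H.obj b).right.carrier p) :
      SubfunctorRel (.map f) ⟨b, p, x⟩ ⟨b, p, x⟩ ⟨b', p, GrAlg.app (H.map f) p x⟩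
  | lift {b b₁ b₂ : B} (f : b ⟶ b₁) (g : b ⟶ b₂) {p : ℤ} (x : (H.obj b).right.carrier p)
      (h : ∀ y, GrAlg.app (H.map f) p y = GrAlg.app (H.map f) p x →
        GrAlg.app (H.map g) p y = GrAlg.app (H.map g) p x → y = x) :
      SubfunctorRel (.lift f g) ⟨b₁, p, GrAlg.app (H.map f) p x⟩
        ⟨b₂, p, GrAlg.app (H.map g) p x⟩ ⟨b, p, x⟩

lemma SubfunctorRel.lift_inv {b b₁ b₂ : B} {f : b ⟶ b₁} {g : b ⟶ b₂}
    {x y z : Σ (b : B) (p : ℤ), (H.obj b).right.carrier p}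
    (h : SubfunctorRel H (.lift f g) x y z) :
    ∃ (p : ℤ) (w : (H.obj b).right.carrier p), x = ⟨b₁, p, GrAlg.app (H.map f) p w⟩ ∧
      y = ⟨b₂, p, GrAlg.app (H.map g) p w⟩ ∧ z = ⟨b, p, w⟩ := by
  cases h with
  | lift _ _ x _ => exact ⟨_, x, rfl, rfl, rfl⟩

/-- Only `lift` needs an argument: its joint injectivity hypothesis at `x` is what makes it
single-valued, so that closing under it does not raise the cardinality bound. -/
lemma SubfunctorRel.unique {n : SubfunctorOp B}
    {x y z z' : Σ (b : B) (p : ℤ), (H.obj b).right.carrier p}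
    (h : SubfunctorRel H n x y z) (h' : SubfunctorRel H n x y z') : z = z' := by
  cases h with
  | add x y => cases h'; rfl
  | neg x => cases h'; rfl
  | mul x y => cases h'; rfl
  | map f x => cases h'; rfl
  | lift f g x h =>
    obtain ⟨p', x', hu, hv, rfl⟩ := SubfunctorRel.lift_inv H h'
    simp only [Sigma.mk.injEq, heq_eq_eq, true_and] at hu hv
    obtain ⟨rfl, hu⟩ := hu
    obtain ⟨-, hv⟩ := hv
    rw [h x' (eq_of_heq hu).symm (eq_of_heq hv).symm]

/-- A functor from a small category to graded algebras has small subfunctors that contain a given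
small family of elements and are closed under unique lifts of elements along jointly injective
pairs of maps. -/
theorem exists_small_subfunctor {κ : Cardinal.{u}} (hκ : ℵ₀ ≤ κ) (hk : ∀ p, #(k.carrier p) ≤ κ)
    (hB : #B ≤ κ) (hop : #(SubfunctorOp B) ≤ κ)
    (S : ∀ (b : B) (p : ℤ), Set ((H.obj b).right.carrier p)) (hS : ∀ b p, #(S b p) ≤ κ) :
    ∃ (G : B ⥤ GrAlg k) (m : G ⟶ H), (∀ b p, Function.Injective (GrAlg.app (m.app b) p)) ∧
      (∀ b, sizeLE k κ (G.obj b)) ∧ (∀ b p, S b p ⊆ Set.range (GrAlg.app (m.app b) p)) ∧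
      ∀ {b b₁ b₂ : B} (f : b ⟶ b₁) (g : b ⟶ b₂) (p : ℤ) (x : (H.obj b).right.carrier p),
        (∀ y, GrAlg.app (H.map f) p y = GrAlg.app (H.map f) p x →
          GrAlg.app (H.map g) p y = GrAlg.app (H.map g) p x → y = x) →
        GrAlg.app (H.map f) p x ∈ Set.range (GrAlg.app (m.app b₁) p) →
        GrAlg.app (H.map g) p x ∈ Set.range (GrAlg.app (m.app b₂) p) →
        x ∈ Set.range (GrAlg.app (m.app b) p) := by
  have hℤ : lift.{u} #ℤ ≤ lift.{0} κ := by simpa using hκ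
  have hsig (f : B → ℤ → Type u) (hf : ∀ b p, #(f b p) ≤ κ) : #(Σ (b : B) (p : ℤ), f b p) ≤ κ := by
    simpa using mk_sigma_le hκ (by simpa using hB)
      fun b => (mk_sigma_le hκ hℤ (hf b)).trans_eq (lift_uzero κ)
  -- Pooling the elements of all objects and degrees lets one closure argument treat all operations
  -- at once. The scalars are included so that the closure contains zero, one and the image of `k`.
  let Z := Σ (b : B) (p : ℤ), (H.obj b).right.carrier p
  let S₁ : Set Z := Set.range fun s : Σ (b : B) (p : ℤ), S b p => ⟨s.1, s.2.1, s.2.2.1⟩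
  let S₂ : Set Z := Set.range fun s : Σ (_ : B) (p : ℤ), k.carrier p =>
    ⟨s.1, s.2.1, GrAlg.scalar (H.obj s.1) s.2.1 s.2.2⟩
  obtain ⟨T, hST, hT, hcl⟩ := exists_closed_superset hκ hop (SubfunctorRel H)
    (fun _ _ _ _ _ => SubfunctorRel.unique H) (S₁ ∪ S₂)
    ((mk_union_le _ _).trans ((add_le_add (mk_range_le.trans (hsig _ hS))
      (mk_range_le.trans (hsig _ fun _ => hk))).trans_eq (add_eq_self hκ)))
  have hscalar (b : B) (p : ℤ) (c : k.carrier p) :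
      (⟨b, p, GrAlg.scalar (H.obj b) p c⟩ : Z) ∈ T := hST (Or.inr ⟨⟨b, p, c⟩, rfl⟩)
  let U (b : B) : GrCommRing.Sub (H.obj b).right :=
    { carrier := fun p =>
        { carrier := {x | (⟨b, p, x⟩ : Z) ∈ T}
          zero_mem' := by simpa using hscalar b p 0
          add_mem' := fun hx hy => hcl _ _ _ _ hx hy (.add _ _)
          neg_mem' := fun hx => hcl _ _ _ _ hx hx (.neg _) }
      one_mem := by
        have := hscalar b 0 k.one
        rwa [show GrAlg.scalar (H.obj b) 0 k.one = (H.obj b).right.one from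
          GrCommRing.Hom.map_one _] at this
      mul_mem := fun h x y hx hy => by
        subst h
        exact hcl _ _ _ _ hx hy (.mul _ _) }
  obtain ⟨G, m, hm, hG⟩ := GrAlg.exists_subfunctor H U hscalar fun f p x hx =>
    hcl _ _ _ _ hx hx (.map f x)
  refine ⟨G, m, hm, fun b p => ?_, fun b p x hx => ?_, ?_⟩
  · refine (mk_le_of_injective (β := T) (f := fun x => ⟨⟨b, p, GrAlg.app (m.app b) p x⟩,
      (hG b p _).1 ⟨x, rfl⟩⟩) fun x y h => hm b p ?_).trans hT
    simpa [Subtype.ext_iff] using h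
  · exact (hG _ _ _).2 (hST (Or.inl ⟨⟨b, p, x, hx⟩, rfl⟩))
  · intro b b₁ b₂ f g p x h hf hg
    exact (hG _ _ _).2 (hcl _ _ _ _ ((hG _ _ _).1 hf) ((hG _ _ _).1 hg) (.lift f g x h))

end Subfunctor

/-- Over the one-object category, subfunctors of a constant functor are just subalgebras; finiteness
supplies the bound on operations for that case. -/
instance : Finite (SubfunctorOp (Discrete PUnit.{u + 1})) :=
  Finite.of_surjective (α := Fin 5) (fun
    | 0 => .add
    | 1 => .neg
    | 2 => .mul
    | 3 => .map (𝟙 (⟨⟨⟩⟩ : Discrete PUnit))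
    | 4 => .lift (𝟙 (⟨⟨⟩⟩ : Discrete PUnit)) (𝟙 (⟨⟨⟩⟩ : Discrete PUnit))) fun
    | .add => ⟨0, rfl⟩
    | .neg => ⟨1, rfl⟩
    | .mul => ⟨2, rfl⟩
    | .map (b := ⟨⟨⟩⟩) (b' := ⟨⟨⟩⟩) _ => ⟨3, rfl⟩
    | .lift (b := ⟨⟨⟩⟩) (b₁ := ⟨⟨⟩⟩) (b₂ := ⟨⟨⟩⟩) _ _ => ⟨4, rfl⟩

/-- A graded algebra has small subalgebras containing a given small set of elements. -/
theorem exists_small_subalgebra {κ : Cardinal.{u}} (hκ : ℵ₀ ≤ κ) (hk : ∀ p, #(k.carrier p) ≤ κ)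
    (T : GrAlg k) (S : ∀ p : ℤ, Set (T.right.carrier p)) (hS : ∀ p, #(S p) ≤ κ) :
    ∃ (R : GrAlg k) (m : R ⟶ T), (∀ p, Function.Injective (GrAlg.app m p)) ∧ sizeLE k κ R ∧
      ∀ p, S p ⊆ Set.range (GrAlg.app m p) := by
  obtain ⟨G, m, h₁, h₂, h₃, -⟩ := exists_small_subfunctor
    ((Functor.const (Discrete PUnit.{u + 1})).obj T) hκ hk ((mk_le_aleph0 (α := Discrete PUnit)).trans hκ)
    ((mk_le_aleph0).trans hκ) (fun _ => S) (fun _ => hS)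
  exact ⟨G.obj ⟨⟨⟩⟩, m.app ⟨⟨⟩⟩, h₁ _, h₂ _, h₃ _⟩

end

/-! ### Small algebras and the characterization of formal schemes -/

section

open Cardinal Opposite

namespace GrCommRing

/-- Transport of the structure of a graded ring along bijections. -/
def transport (A : GrCommRing.{u}) (c : ℤ → Type u) (e : ∀ p, A.carrier p ≃ c p) :
    GrCommRing.{u} :=
  letI (p : ℤ) : AddCommGroup (c p) := (e p).symm.addCommGroup
  letI e' (p : ℤ) : A.carrier p ≃+ c p := ((e p).symm.addEquiv).symm
  { carrier := c
    one := e' 0 A.one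
    mul := fun {p q r} h => AddMonoidHom.mk' (fun x => AddMonoidHom.mk'
      (fun y => e' r (A.mul h ((e' p).symm x) ((e' q).symm y))) (by simp))
      fun x y => AddMonoidHom.ext (by simp)
    one_mul := by simp [A.one_mul]
    mul_one := by simp [A.mul_one]
    mul_assoc := fun hs ht hw hw' x y z => by simp [A.mul_assoc hs ht hw hw']
    mul_comm := fun h h' x y => by
      simp [A.mul_comm h h' ((e' _).symm x)] }

/-- The comparison with the transport of structure along bijections. -/
def transportHom (A : GrCommRing.{u}) (c : ℤ → Type u) (e : ∀ p, A.carrier p ≃ c p) :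
    A ⟶ A.transport c e :=
  letI (p : ℤ) : AddCommGroup (c p) := (e p).symm.addCommGroup
  { toFun := fun p => ((e p).symm.addEquiv).symm.toAddMonoidHom
    map_one := rfl
    map_mul := fun {p q r} h x y => congr_arg (e r)
      (congr_arg₂ (fun a b => A.mul h a b) ((e p).symm_apply_apply x).symm
        ((e q).symm_apply_apply y).symm) }

instance (A : GrCommRing.{u}) (c : ℤ → Type u) (e : ∀ p, A.carrier p ≃ c p) :
    IsIso (A.transportHom c e) :=
  isIso_of_bijective _ fun p => (e p).bijective

instance small_carrier_eq (c : ℤ → Type u) : Small.{u} {A : GrCommRing.{u} // A.carrier = c} := by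
  let D (A : GrCommRing.{u}) : (∀ p, AddCommGroup (A.carrier p)) × A.carrier 0 ×
      (∀ p q r, p + q = r → A.carrier p → A.carrier q → A.carrier r) :=
    ⟨A.addCommGroup, A.one, fun _ _ _ h x y => A.mul h x y⟩
  let E (A : {A : GrCommRing.{u} // A.carrier = c}) : (∀ p, AddCommGroup (c p)) × c 0 ×
      (∀ p q r, p + q = r → c p → c q → c r) := A.2 ▸ D A.1
  refine small_of_injective (f := E) ?_
  rintro ⟨⟨c, one, mul, _, _, _, _⟩, rfl⟩ ⟨⟨c', one', mul', _, _, _, _⟩, h⟩ hE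
  dsimp only at h
  subst h
  simp only [E, D, Prod.mk.injEq] at hE
  obtain ⟨h₁, h₂, h₃⟩ := hE
  subst h₁ h₂
  have : @mul = @mul' := by
    funext p q r h
    ext x y
    exact congr_fun (congr_fun (congr_fun (congr_fun (congr_fun (congr_fun h₃ p) q) r) h) x) y
  subst this
  rfl

end GrCommRing

variable {k : GrCommRing.{u}}

lemma exists_small_skeleton_sizeLE (k : GrCommRing.{u}) (κ : Cardinal.{u}) :
    ∃ (I : Type u) (R : I → GrAlg k), ∀ T, sizeLE k κ T → ∃ i, Nonempty (T ≅ R i) := by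
  let K : Type u := κ.out
  let I := Σ (Y : ℤ → Set K) (A : {A : GrCommRing.{u} // A.carrier = fun p => ↥(Y p)}), k ⟶ A.1
  have (A : GrCommRing.{u}) : Small.{u} (k ⟶ A) := small_self (k ⟶ A)
  refine ⟨Shrink.{u} I, fun i => Under.mk ((equivShrink I).symm i).2.2, fun T hT => ?_⟩
  have hf (p : ℤ) : Nonempty (T.right.carrier p ↪ K) := by
    rw [← le_def]
    exact (hT p).trans_eq (mk_out κ).symm
  let e (p : ℤ) := Equiv.ofInjective _ (hf p).some.injective
  let a : I := ⟨_, ⟨T.right.transport _ e, rfl⟩, T.hom ≫ T.right.transportHom _ e⟩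
  refine ⟨equivShrink I a, ⟨?_⟩⟩
  change T ≅ Under.mk ((equivShrink I).symm (equivShrink I a)).2.2
  rw [Equiv.symm_apply_apply]
  exact Under.isoMk (asIso (T.right.transportHom _ e)) rfl

instance (κ : Cardinal.{u}) : ObjectProperty.EssentiallySmall.{u} (sizeLE k κ) := by
  obtain ⟨I, R, hR⟩ := exists_small_skeleton_sizeLE k κ
  refine ⟨ObjectProperty.ofObj R, inferInstance, fun T hT => ?_⟩
  obtain ⟨i, e⟩ := hR T hT
  exact ⟨R i, ⟨i⟩, e⟩

lemma isClosedUnderLimitsOfShape_sizeLE {κ : Cardinal.{u}} (hκ : ℵ₀ ≤ κ) (J : Type) [SmallCategory J]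
    [FinCategory J] : (sizeLE k κ).IsClosedUnderLimitsOfShape J where
  limitsOfShape_le := by
    rintro T ⟨h⟩ p
    let c := (GrAlg.degree k p).mapCone h.cone
    have hc : IsLimit c := isLimitOfPreserves (GrAlg.degree k p) h.isLimit
    refine (mk_le_of_injective (f := fun (x : T.right.carrier p) (j : J) => GrAlg.app (h.π.app j) p x)
      fun x y hxy => ?_).trans ?_
    · have := (Types.isLimit_iff c).1 ⟨hc⟩ (fun j => c.π.app j x)
        fun f => ConcreteCategory.congr_hom (c.w f) x
      exact this.unique (fun _ => rfl) fun j => (congr_fun hxy j).symm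
    · rw [mk_pi]
      refine (prod_le_prod _ (fun _ => κ) fun j => h.prop_diag_obj j p).trans ?_
      rw [prod_const, mk_fintype, lift_natCast, lift_uzero]
      exact power_nat_le hκ

/-- Every element of `X` is supported on a graded algebra of size at most `κ`. -/
def IsSupported (κ : Cardinal.{u}) (X : GrAlg k ⥤ Type u) : Prop :=
  ∀ (T : GrAlg k) (x : X.obj T), ∃ (S : GrAlg k) (f : S ⟶ T) (y : X.obj S),
    sizeLE k κ S ∧ X.map f y = x

lemma IsSupported.mono {κ κ' : Cardinal.{u}} (h : κ ≤ κ') {X : GrAlg k ⥤ Type u}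
    (hX : IsSupported κ X) : IsSupported κ' X := fun T x => by
  obtain ⟨S, f, y, hS, hy⟩ := hX T x
  exact ⟨S, f, y, fun p => (hS p).trans h, hy⟩

lemma exists_sizeLE {I : Type u} (T : I → GrAlg k) : ∃ κ, ∀ i, sizeLE k κ (T i) :=
  ⟨sum fun j : I × ULift.{u} ℤ => #((T j.1).right.carrier j.2.down), fun i p =>
    le_sum (fun j : I × ULift.{u} ℤ => #((T j.1).right.carrier j.2.down)) (i, ⟨p⟩)⟩

/-- Representables are left exact, and filtered colimits of sets commute with finite limits. -/
lemma isFormalScheme.preservesFiniteLimits {X : GrAlg k ⥤ Type u} (hX : isFormalScheme k X) :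
    PreservesFiniteLimits X := by
  obtain ⟨⟨P⟩⟩ := hX
  have : PreservesFiniteLimits (unopUnop (GrAlg k) ⋙ X) :=
    (ObjectProperty.preservesFiniteLimits).prop_of_isColimit P.isColimit fun i =>
      inferInstanceAs (PreservesFiniteLimits (yoneda.obj (P.F.obj i)))
  exact inferInstanceAs (PreservesFiniteLimits (opOp (GrAlg k) ⋙ unopUnop (GrAlg k) ⋙ X))

/-- An element of the colimit comes from a map out of one of the representing algebras, hence is the
image of the universal element there; `κ` bounds this small family of algebras. -/
lemma isFormalScheme.exists_isSupported {X : GrAlg k ⥤ Type u} (hX : isFormalScheme k X) :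
    ∃ κ, IsSupported κ X := by
  obtain ⟨⟨P⟩⟩ := hX
  obtain ⟨κ, hκ⟩ := exists_sizeLE fun i => (P.F.obj i).unop
  refine ⟨κ, fun T x => ?_⟩
  obtain ⟨i, f, hf⟩ := Types.jointly_surjective_of_isColimit
    (isColimitOfPreserves ((evaluation _ _).obj (op (op T))) P.isColimit) x
  refine ⟨_, Quiver.Hom.unop f, (P.ι.app i).app (op (P.F.obj i)) (𝟙 _), hκ i, ?_⟩
  rw [← hf]
  let f' : op T ⟶ P.F.obj i := f
  have h := ConcreteCategory.congr_hom (C := Type u) ((P.ι.app i).naturality f'.op)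
    (𝟙 (P.F.obj i))
  exact h.symm.trans (congr_arg (fun g => (P.ι.app i).app (op (op T)) g) (Category.comp_id f'))

theorem isFormalScheme_iff (X : GrAlg k ⥤ Type u) :
    isFormalScheme k X ↔ PreservesFiniteLimits X ∧ ∃ κ, IsSupported κ X := by
  refine ⟨fun h => ⟨h.preservesFiniteLimits, h.exists_isSupported⟩, ?_⟩
  rintro ⟨_, κ, hκ⟩
  have : PreservesFiniteLimits (unopUnop (GrAlg k) ⋙ X) := comp_preservesFiniteLimits _ _
  have := isFiltered_costructuredArrow_yoneda_of_preservesFiniteLimits (unopUnop (GrAlg k) ⋙ X)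
  refine (isIndObject_iff _).2 ⟨this, ?_⟩
  -- Finality reduces to a small weakly terminal set: the elements over representatives of the
  -- `κ`-small algebras, to which bounded support maps every other element.
  obtain ⟨I, R, hR⟩ := exists_small_skeleton_sizeLE k κ
  refine finallySmall_of_small_weakly_terminal_set
    (Set.range fun a : Σ i, X.obj (R i) => CostructuredArrow.mk
      (yonedaEquiv.symm a.2 : yoneda.obj (op (R a.1)) ⟶ unopUnop (GrAlg k) ⋙ X)) fun a => ?_
  obtain ⟨S, f, y, hS, hy⟩ := hκ a.left.unop (yonedaEquiv a.hom)
  obtain ⟨i, ⟨e⟩⟩ := hR S hS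
  refine ⟨_, ⟨⟨i, X.map e.hom y⟩, rfl⟩, ⟨CostructuredArrow.homMk (e.inv ≫ f).op ?_⟩⟩
  apply yonedaEquiv.injective
  refine (congr_arg _ (yonedaEquiv_symm_naturality_left _ _ _)).trans
    ((Equiv.apply_symm_apply _ _).trans ?_)
  rw [← hy]
  change X.map (e.inv ≫ f) (X.map e.hom y) = X.map f y
  rw [← comp_apply, ← Functor.map_comp, e.hom_inv_id_assoc]

end

/-! ### Closure of formal schemes under limits and composition -/

section

open Cardinal Opposite

instance isClosedUnderLimitsOfShape_preservesLimitsOfShape {A J D K : Type*} [Category* A]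
    [Category* J] [Category* D] [Category* K] [HasLimitsOfShape J D] :
    (ObjectProperty.preservesLimitsOfShape K : ObjectProperty (A ⥤ D)).IsClosedUnderLimitsOfShape
      J where
  limitsOfShape_le := by
    rintro G ⟨h⟩
    have := h.prop_diag_obj
    -- Limits commute with limits: `G` is the flipped diagram followed by `lim`, and both preserve
    -- limits of shape `K`.
    have : PreservesLimitsOfShape K h.diag.flip := ⟨fun {F} => ⟨fun {c} hc =>
      ⟨evaluationJointlyReflectsLimits _
        (fun j => isLimitOfPreserves (h.diag.obj j) hc)⟩⟩⟩
    have : PreservesLimitsOfShape K (lim : (J ⥤ D) ⥤ D) := inferInstance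
    let e : h.diag.flip ⋙ lim ≅ G :=
      NatIso.ofComponents
        (fun a => (limit.isLimit (h.diag.flip.obj a)).conePointUniqueUpToIso
          (isLimitOfPreserves ((evaluation _ _).obj a) h.isLimit))
        (fun {a b} f => by
          apply (isLimitOfPreserves ((evaluation _ _).obj b) h.isLimit).hom_ext
          intro j
          have h₁ := IsLimit.conePointUniqueUpToIso_hom_comp
            (limit.isLimit (h.diag.flip.obj a)) (isLimitOfPreserves ((evaluation _ _).obj a) h.isLimit) j
          have h₂ := IsLimit.conePointUniqueUpToIso_hom_comp
            (limit.isLimit (h.diag.flip.obj b)) (isLimitOfPreserves ((evaluation _ _).obj b) h.isLimit) j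
          simp at h₁ h₂ ⊢
          simp [h₂, reassoc_of% h₁])
    exact preservesLimitsOfShape_of_natIso e

instance isClosedUnderLimitsOfShape_preservesFiniteLimits {A J D : Type*} [Category* A]
    [Category* J] [Category* D] [HasLimitsOfShape J D] :
    (ObjectProperty.preservesFiniteLimits : ObjectProperty (A ⥤ D)).IsClosedUnderLimitsOfShape
      J where
  limitsOfShape_le := by
    rintro G ⟨h⟩
    have := h.prop_diag_obj
    exact ⟨fun K _ _ =>
      (ObjectProperty.preservesLimitsOfShape K).prop_of_isLimit h.isLimit inferInstance⟩

variable {k : GrCommRing.{u}}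

/-- The infinite cardinals bounding the cardinality of the homogeneous components of `k`. -/
structure IsLarge (k : GrCommRing.{u}) (κ : Cardinal.{u}) : Prop where
  aleph0_le : ℵ₀ ≤ κ
  mk_le (p : ℤ) : #(k.carrier p) ≤ κ

lemma exists_isLarge (k : GrCommRing.{u}) (κ : Cardinal.{u}) : ∃ κ', κ ≤ κ' ∧ IsLarge k κ' :=
  ⟨max κ (max ℵ₀ (sum fun p : ULift.{u} ℤ => #(k.carrier p.down))), le_max_left _ _,
    (le_max_left _ _).trans (le_max_right _ _), fun p =>
    (le_sum (fun p : ULift.{u} ℤ => #(k.carrier p.down)) ⟨p⟩).trans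
      ((le_max_right _ _).trans (le_max_right _ _))⟩

/-- A small family of maps from small graded algebras factors through a small subalgebra. -/
lemma IsLarge.exists_factorization {κ : Cardinal.{u}} (hκ : IsLarge k κ) {I : Type u}
    (hI : #I ≤ κ) {T : GrAlg k} (S : I → GrAlg k) (hS : ∀ i, sizeLE k κ (S i))
    (f : ∀ i, S i ⟶ T) :
    ∃ (R : GrAlg k) (m : R ⟶ T) (g : ∀ i, S i ⟶ R), sizeLE k κ R ∧
      (∀ p, Function.Injective (GrAlg.app m p)) ∧ ∀ i, g i ≫ m = f i := by
  obtain ⟨R, m, hm, hR, h⟩ := exists_small_subalgebra hκ.1 hκ.2 T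
    (fun p => Set.range fun s : Σ i, (S i).right.carrier p => GrAlg.app (f s.1) p s.2)
    fun p => mk_range_le.trans (by
      simpa using mk_sigma_le hκ.1 (by simpa using hI) fun i => hS i p)
  choose g hg using fun i => GrAlg.exists_lift m hm (f i) fun p x => h p ⟨⟨i, x⟩, rfl⟩
  exact ⟨R, m, g, hR, hm, hg⟩

lemma map_injective {X : GrAlg k ⥤ Type u} [PreservesFiniteLimits X] {S T : GrAlg k} (m : S ⟶ T)
    (hm : ∀ p, Function.Injective (GrAlg.app m p)) : Function.Injective (X.map m) :=
  have := GrAlg.mono_of_injective m hm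
  (mono_iff_injective (X.map m)).1 inferInstance

instance (J : Type u) [SmallCategory J] :
    (isFormalScheme k).IsClosedUnderLimitsOfShape J where
  limitsOfShape_le := by
    rintro X ⟨h⟩
    have hD (j : J) := (isFormalScheme_iff (h.diag.obj j)).1 (h.prop_diag_obj j)
    have (j : J) : PreservesFiniteLimits (h.diag.obj j) := (hD j).1
    choose κ₀ hκ₀ using fun j => (hD j).2
    -- Bounding `#J` as well lets the supports of all components of `x` fit into a single small
    -- subalgebra `R`.
    obtain ⟨κ, hle, hκ⟩ := exists_isLarge k (max (sum κ₀) #J)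
    have hsupp (j : J) : IsSupported κ (h.diag.obj j) :=
      (hκ₀ j).mono ((le_sum κ₀ j).trans ((le_max_left _ _).trans hle))
    refine (isFormalScheme_iff X).2
      ⟨(ObjectProperty.preservesFiniteLimits).prop_of_isLimit h.isLimit fun j => (hD j).1, κ,
        fun T x => ?_⟩
    have hlim (T : GrAlg k) := (Types.isLimit_iff _).1
      ⟨isLimitOfPreserves ((evaluation (GrAlg k) (Type u)).obj T) h.isLimit⟩
    choose S f y hS hy using fun j => hsupp j T ((h.π.app j).app T x)
    obtain ⟨R, m, g, hR, hm, hg⟩ := hκ.exists_factorization ((le_max_right _ _).trans hle) S hS f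
    have hz (j : J) : (h.diag.obj j).map m ((h.diag.obj j).map (g j) (y j)) =
        (h.π.app j).app T x := by
      rw [← hy, ← hg, Functor.map_comp, comp_apply]
    -- The components over `R` form a compatible family because their images over `T` do and `m`
    -- induces injections.
    obtain ⟨z, hz', -⟩ := hlim R (fun j => (h.diag.obj j).map (g j) (y j)) fun {i j} a => by
      apply map_injective (X := h.diag.obj j) m hm
      have h₁ := ConcreteCategory.congr_hom (C := Type u) ((h.diag.map a).naturality m)
        ((h.diag.obj i).map (g i) (y i))
      have h₂ := ConcreteCategory.congr_hom (C := Type u) (NatTrans.congr_app (h.π.naturality a) T) x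
      rw [hz]
      refine h₁.symm.trans ((congr_arg (fun z => (h.diag.map a).app T z) (hz i)).trans ?_)
      exact h₂.symm
    refine ⟨R, m, z, hR, (hlim T (fun j => (h.π.app j).app T x) fun {i j} a =>
      (ConcreteCategory.congr_hom (C := Type u) (NatTrans.congr_app (h.π.naturality a) T) x).symm).unique
      (y₁ := X.map m z) (y₂ := x) (fun j => ?_) fun j => rfl⟩
    refine (ConcreteCategory.congr_hom (C := Type u) ((h.π.app j).naturality m) z).trans ?_
    rw [← hz, ← hz']
    rfl

lemma isFormalAlgebraScheme.preservesFiniteLimits {F : GrAlg k ⥤ GrAlg k}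
    (hF : isFormalAlgebraScheme k F) : PreservesFiniteLimits F :=
  GrAlg.preservesFiniteLimits_of_degree F fun p => (hF p).preservesFiniteLimits

lemma isFormalAlgebraScheme.exists_isSupported {F : GrAlg k ⥤ GrAlg k}
    (hF : isFormalAlgebraScheme k F) : ∃ κ, ∀ p, IsSupported κ (F ⋙ GrAlg.degree k p) := by
  choose κ hκ using fun p => (hF p).exists_isSupported
  exact ⟨sum fun p : ULift.{u} ℤ => κ p.down, fun p =>
    (hκ p).mono (le_sum (fun p : ULift.{u} ℤ => κ p.down) ⟨p⟩)⟩

instance (J : Type u) [SmallCategory J] :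
    (isFormalAlgebraScheme k).IsClosedUnderLimitsOfShape J where
  limitsOfShape_le := by
    rintro F ⟨h⟩ p
    exact (isFormalScheme k).prop_of_isLimit (isLimitOfPreserves
      ((Functor.whiskeringRight _ _ _).obj (GrAlg.degree k p)) h.isLimit)
      fun j => h.prop_diag_obj j p

instance : HasLimitsOfSize.{u, u} (FAlgSch k) where
  has_limits_of_shape _ _ := inferInstance

lemma isFormalAlgebraScheme_id : isFormalAlgebraScheme k (𝟭 _) := fun p => by
  obtain ⟨κ, -, hκ⟩ := exists_isLarge k 0
  refine (isFormalScheme_iff _).2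
    ⟨inferInstanceAs (PreservesFiniteLimits (GrAlg.degree k p)), κ, fun T x => ?_⟩
  -- The prescribed set is `{x}` in degree `p` and empty in every other degree.
  obtain ⟨R, m, -, hR, h⟩ := exists_small_subalgebra hκ.1 hκ.2 T
    (fun q => {y | ∃ h : p = q, h ▸ x = y}) fun q => by
      refine (Cardinal.le_one_iff_subsingleton.2 ⟨?_⟩).trans (one_le_aleph0.trans hκ.1)
      rintro ⟨_, rfl, rfl⟩ ⟨_, _, rfl⟩
      rfl
  obtain ⟨y, hy⟩ := h p ⟨rfl, rfl⟩
  exact ⟨R, m, y, hR, hy⟩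

/-- An element of `X(F(T))` is supported on a small `S` with a map `f : S ⟶ F(T)`. Each value of `f`
is supported on a small algebra over `T`; there are few of them, so one small `Q ⊆ T` serves for
all. As `F(Q)` embeds in `F(T)`, the map `f` factors through `F(Q)`. -/
lemma isFormalScheme_comp {F : GrAlg k ⥤ GrAlg k} (hF : isFormalAlgebraScheme k F)
    {X : GrAlg k ⥤ Type u} (hX : isFormalScheme k X) : isFormalScheme k (F ⋙ X) := by
  have := hX.preservesFiniteLimits
  have := hF.preservesFiniteLimits
  obtain ⟨κ₁, h₁⟩ := hF.exists_isSupported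
  obtain ⟨κ₂, h₂⟩ := hX.exists_isSupported
  obtain ⟨κ, hle, hκ⟩ := exists_isLarge k (max κ₁ κ₂)
  replace h₁ p := (h₁ p).mono ((le_max_left _ _).trans hle)
  replace h₂ := h₂.mono ((le_max_right _ _).trans hle)
  refine (isFormalScheme_iff _).2 ⟨comp_preservesFiniteLimits _ _, κ, fun T x => ?_⟩
  obtain ⟨S, f, y, hS, hy⟩ := h₂ (F.obj T) x
  choose R g z hR hz using fun s : Σ p, S.right.carrier p => h₁ s.1 T (GrAlg.app f s.1 s.2)
  obtain ⟨Q, m, h, hQ, hm, hh⟩ := hκ.exists_factorization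
    ((mk_sigma_le hκ.1 (by simpa using hκ.1) hS).trans_eq (lift_uzero κ)) R hR g
  obtain ⟨f', hf'⟩ := GrAlg.exists_lift (F.map m)
    (fun p => map_injective (X := F ⋙ GrAlg.degree k p) m hm) f fun p x =>
      ⟨GrAlg.app (F.map (h ⟨p, x⟩)) p (z ⟨p, x⟩), (congr_arg (fun g => GrAlg.app g p (z ⟨p, x⟩))
        ((F.map_comp _ _).symm.trans (congr_arg F.map (hh _)))).trans (hz ⟨p, x⟩)⟩
  refine ⟨Q, m, X.map f' y, hQ, ?_⟩
  rw [Functor.comp_map, ← comp_apply, ← X.map_comp, hf', hy]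

lemma isGradedFormalScheme_comp {F : GrAlg k ⥤ GrAlg k} (hF : isFormalAlgebraScheme k F)
    {X : GrAlg k ⥤ (ℤ → Type u)} (hX : isGradedFormalScheme k X) :
    isGradedFormalScheme k (F ⋙ X) :=
  fun p => isFormalScheme_comp hF (hX p)

lemma isFormalAlgebraScheme_comp {F G : GrAlg k ⥤ GrAlg k} (hF : isFormalAlgebraScheme k F)
    (hG : isFormalAlgebraScheme k G) : isFormalAlgebraScheme k (F ⋙ G) :=
  isGradedFormalScheme_comp hF hG

end

/-! ### Composition as a monoidal structure and as a right action -/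

section

section Composition

attribute [local instance] endofunctorMonoidalCategory

variable {A : Type u₁} [Category.{v₁} A] {D : Type u₂} [Category.{v₂} D]
  (P : ObjectProperty (A ⥤ A)) (hid : P (𝟭 A)) (hcomp : ∀ {F G}, P F → P G → P (F ⋙ G))

instance : (toEndofunctors P).Faithful :=
  have : (mopFunctor (A ⥤ A)).Faithful := ⟨fun h => congr_arg Quiver.Hom.unmop h⟩
  inferInstanceAs (P.ι ⋙ mopFunctor (A ⥤ A)).Faithful

/-- Composition of functors as a tensor product on a full subcategory of endofunctors that
contains the identity and is closed under composition. -/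
@[reducible]
def compositionMonoidalCategoryStruct : MonoidalCategoryStruct P.FullSubcategory where
  tensorObj F G := ⟨G.obj ⋙ F.obj, hcomp G.property F.property⟩
  whiskerLeft F _ _ g := P.homMk (Functor.whiskerRight g.hom F.obj)
  whiskerRight f G := P.homMk (Functor.whiskerLeft G.obj f.hom)
  tensorHom f g := P.homMk (g.hom ◫ f.hom)
  tensorUnit := ⟨𝟭 A, hid⟩
  associator F G H := P.isoMk (Functor.associator H.obj G.obj F.obj).symm
  leftUnitor F := P.isoMk (Functor.rightUnitor F.obj)
  rightUnitor F := P.isoMk (Functor.leftUnitor F.obj)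

/-- The inclusion into all endofunctors takes the composition of functors to the tensor product. -/
def compositionInducingFunctorData :
    letI := compositionMonoidalCategoryStruct P hid hcomp
    Monoidal.InducingFunctorData (toEndofunctors P) :=
  letI := compositionMonoidalCategoryStruct P hid hcomp
  { μIso := fun _ _ => Iso.refl _
    εIso := Iso.refl _
    whiskerLeft_eq := fun _ _ _ _ => ((Category.id_comp _).trans (Category.comp_id _)).symm
    whiskerRight_eq := fun _ _ => ((Category.id_comp _).trans (Category.comp_id _)).symm
    tensorHom_eq := fun _ _ => ((Category.id_comp _).trans (Category.comp_id _)).symm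
    associator_eq := fun F G H => by
      apply Quiver.Hom.unmop_inj
      ext T
      change 𝟙 _ = (𝟙 _ ≫ (𝟙 _ ≫ F.obj.map (G.obj.map (𝟙 _)))) ≫ 𝟙 _ ≫ ((𝟙 _ ≫ F.obj.map (𝟙 _)) ≫ 𝟙 _)
      simp
    leftUnitor_eq := fun F => by
      apply Quiver.Hom.unmop_inj
      ext T
      change 𝟙 (F.obj.obj T) = (𝟙 (F.obj.obj T) ≫ (𝟙 (F.obj.obj T) ≫ 𝟙 (F.obj.obj T))) ≫ 𝟙 _
      simp
    rightUnitor_eq := fun F => by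
      apply Quiver.Hom.unmop_inj
      ext T
      change 𝟙 _ = (𝟙 _ ≫ (𝟙 _ ≫ F.obj.map (𝟙 _))) ≫ 𝟙 _
      simp }

/-- Composition of functors as a monoidal structure on a full subcategory of endofunctors that
contains the identity and is closed under composition. -/
@[reducible]
def compositionMonoidalCategory : MonoidalCategory P.FullSubcategory :=
  letI := compositionMonoidalCategoryStruct P hid hcomp
  Monoidal.induced (toEndofunctors P) (compositionInducingFunctorData P hid hcomp)

/-- The monoidal structure on endofunctors given by composition is given by composition. -/
@[reducible]
def compositionTensorIsComposition :
    letI := compositionMonoidalCategory P hid hcomp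
    TensorIsComposition P :=
  letI := compositionMonoidalCategoryStruct P hid hcomp
  Monoidal.fromInducedMonoidal (toEndofunctors P) (compositionInducingFunctorData P hid hcomp)

/-- The right action by composition of functors. -/
@[reducible]
def compositionRightAction (Q : ObjectProperty (A ⥤ D))
    (hQ : ∀ {F X}, P F → Q X → Q (F ⋙ X)) :
    letI := compositionMonoidalCategory P hid hcomp
    MonoidalRightAction P.FullSubcategory Q.FullSubcategory :=
  letI := compositionMonoidalCategory P hid hcomp
  { actionObj := fun X F => ⟨F.obj ⋙ X.obj, hQ F.property X.property⟩
    actionHomRight := fun X _ _ g => Q.homMk (Functor.whiskerRight g.hom X.obj)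
    actionHomLeft := fun f F => Q.homMk (Functor.whiskerLeft F.obj f.hom)
    actionAssocIso := fun X F G => Q.isoMk (Functor.associator G.obj F.obj X.obj)
    actionUnitIso := fun X => Q.isoMk (Functor.leftUnitor X.obj)
    actionHomRight_id := by
      intros
      ext
      exact CategoryTheory.Functor.map_id _ _
    id_actionHomLeft := by
      intros
      ext
      rfl
    actionHom_comp := fun {F F' F'' X X' X''} f₁ f₂ g₁ g₂ => by
      ext T
      change (f₁.hom.app (F.obj.obj T) ≫ f₂.hom.app (F.obj.obj T)) ≫
        X''.obj.map (g₁.hom.app T ≫ g₂.hom.app T) =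
          (f₁.hom.app (F.obj.obj T) ≫ X'.obj.map (g₁.hom.app T)) ≫
            (f₂.hom.app (F'.obj.obj T) ≫ X''.obj.map (g₂.hom.app T))
      simp
    actionAssocIso_hom_naturality := fun {X X' F F' G G'} f g h => by
      ext T
      change (f.hom.app (F.obj.obj (G.obj.obj T)) ≫
        X'.obj.map (g.hom.app (G.obj.obj T) ≫ F'.obj.map (h.hom.app T))) ≫ 𝟙 _ =
          𝟙 _ ≫ (f.hom.app (F.obj.obj (G.obj.obj T)) ≫ X'.obj.map (g.hom.app (G.obj.obj T))) ≫
            X'.obj.map (F'.obj.map (h.hom.app T))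
      simp
    actionUnitIso_hom_naturality := fun f => by
      ext T
      exact (Category.id_comp _).trans (Category.comp_id _).symm
    actionHomRight_whiskerRight := fun _ _ _ => by
      ext T
      exact ((Category.id_comp _).trans (Category.comp_id _)).symm
    whiskerRight_actionHomLeft := fun _ _ _ _ _ => by
      ext T
      exact ((Category.id_comp _).trans (Category.comp_id _)).symm
    actionHom_associator := fun F G H X => by
      ext T
      change X.obj.map (𝟙 (F.obj.obj (G.obj.obj (H.obj.obj T)))) ≫ 𝟙 _ ≫ 𝟙 _ =
        𝟙 (X.obj.obj (F.obj.obj (G.obj.obj (H.obj.obj T)))) ≫ 𝟙 _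
      simp
    actionHom_leftUnitor := fun F X => by
      ext T
      change X.obj.map (𝟙 (F.obj.obj T)) = 𝟙 _ ≫ 𝟙 _
      simp
    actionHom_rightUnitor := fun F X => by
      ext T
      change X.obj.map (𝟙 (F.obj.obj T)) = 𝟙 _ ≫ 𝟙 _
      simp }

/-- The right action by composition of functors is given by composition of functors. -/
def compositionActionIsComposition (Q : ObjectProperty (A ⥤ D))
    (hQ : ∀ {F X}, P F → Q X → Q (F ⋙ X)) :
    letI := compositionMonoidalCategory P hid hcomp
    letI := compositionTensorIsComposition P hid hcomp
    letI := compositionRightAction P hid hcomp Q hQ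
    ActionIsComposition P Q :=
  letI := compositionMonoidalCategory P hid hcomp
  letI := compositionTensorIsComposition P hid hcomp
  letI := compositionRightAction P hid hcomp Q hQ
  { iso := fun X F => Iso.refl _
    naturality_left := fun _ _ => (Category.comp_id _).trans (Category.id_comp _).symm
    naturality_right := fun _ _ _ _ => (Category.comp_id _).trans (Category.id_comp _).symm
    associativity := fun X F G => by
      ext T
      change 𝟙 (X.obj.obj (F.obj.obj (G.obj.obj T))) ≫ 𝟙 _ ≫ 𝟙 _ =
        𝟙 _ ≫ X.obj.map (𝟙 (F.obj.obj (G.obj.obj T))) ≫ 𝟙 _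
      simp
    unitality := fun X => by
      ext T
      change 𝟙 (X.obj.obj T) = 𝟙 _ ≫ X.obj.map (𝟙 T) ≫ 𝟙 _
      simp }

end Composition

end

/-! ### Restriction to small algebras is fully faithful on functors of bounded support -/

section

open Cardinal

variable {k : GrCommRing.{u}}

/-- A small model of the category of graded algebras whose homogeneous components have cardinality
at most `κ`. -/
abbrev SmallGrAlg (k : GrCommRing.{u}) (κ : Cardinal.{u}) : Type u :=
  SmallModel.{u} (sizeLE k κ).FullSubcategory

namespace SmallGrAlg

/-- The inclusion of small graded algebras into all graded algebras. -/
noncomputable abbrev ι (k : GrCommRing.{u}) (κ : Cardinal.{u}) : SmallGrAlg k κ ⥤ GrAlg k :=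
  (equivSmallModel _).inverse ⋙ (sizeLE k κ).ι

lemma sizeLE_obj {κ : Cardinal.{u}} (b : SmallGrAlg k κ) : sizeLE k κ ((ι k κ).obj b) :=
  ((equivSmallModel _).inverse.obj b).property

lemma exists_iso {κ : Cardinal.{u}} {T : GrAlg k} (hT : sizeLE k κ T) :
    ∃ b : SmallGrAlg k κ, Nonempty ((ι k κ).obj b ≅ T) :=
  ⟨(equivSmallModel _).functor.obj ⟨T, hT⟩,
    ⟨(sizeLE k κ).ι.mapIso
      ((equivSmallModel.{u} (sizeLE k κ).FullSubcategory).unitIso.symm.app ⟨T, hT⟩)⟩⟩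

/-- Two maps from small graded algebras factor through a common small subalgebra. -/
lemma exists_factorization {κ : Cardinal.{u}} (hκ : IsLarge k κ) {b₁ b₂ : SmallGrAlg k κ}
    {T : GrAlg k} (f₁ : (ι k κ).obj b₁ ⟶ T) (f₂ : (ι k κ).obj b₂ ⟶ T) :
    ∃ (b : SmallGrAlg k κ) (m : (ι k κ).obj b ⟶ T) (g₁ : b₁ ⟶ b) (g₂ : b₂ ⟶ b),
      (∀ p, Function.Injective (GrAlg.app m p)) ∧ (ι k κ).map g₁ ≫ m = f₁ ∧
        (ι k κ).map g₂ ≫ m = f₂ := by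
  obtain ⟨R, m, g, hR, hm, hg⟩ := hκ.exists_factorization (I := ULift.{u} Bool)
    ((mk_le_aleph0).trans hκ.1) (fun i => (ι k κ).obj (bif i.down then b₁ else b₂))
    (fun i => sizeLE_obj _) (T := T) (fun | ⟨true⟩ => f₁ | ⟨false⟩ => f₂)
  obtain ⟨b, ⟨e⟩⟩ := exists_iso hR
  refine ⟨b, e.hom ≫ m, (ι k κ).preimage (g ⟨true⟩ ≫ e.inv), (ι k κ).preimage (g ⟨false⟩ ≫ e.inv),
    fun p => (hm p).comp (GrAlg.injective_of_mono e.hom p), ?_, ?_⟩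
  · rw [Functor.map_preimage, Category.assoc, e.inv_hom_id_assoc]
    exact hg ⟨true⟩
  · rw [Functor.map_preimage, Category.assoc, e.inv_hom_id_assoc]
    exact hg ⟨false⟩

lemma exists_of_isSupported {κ : Cardinal.{u}} {F : GrAlg k ⥤ GrAlg k} {p : ℤ}
    (hF : IsSupported κ (F ⋙ GrAlg.degree k p)) {T : GrAlg k} (x : (F.obj T).right.carrier p) :
    ∃ (b : SmallGrAlg k κ) (f : (ι k κ).obj b ⟶ T) (y : (F.obj ((ι k κ).obj b)).right.carrier p),
      GrAlg.app (F.map f) p y = x := by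
  obtain ⟨S, f, y, hS, hy⟩ := hF T x
  obtain ⟨b, ⟨e⟩⟩ := exists_iso hS
  refine ⟨b, e.hom ≫ f, GrAlg.app (F.map e.inv) p y, ?_⟩
  refine Eq.trans ?_ hy
  exact congr_arg (fun g => GrAlg.app g p y) (show F.map e.inv ≫ F.map (e.hom ≫ f) = F.map f by
    rw [← F.map_comp, e.inv_hom_id_assoc])

lemma app_map_injective {F : GrAlg k ⥤ GrAlg k} [PreservesFiniteLimits F] {S T : GrAlg k}
    (m : S ⟶ T) (hm : ∀ p, Function.Injective (GrAlg.app m p)) (p : ℤ) :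
    Function.Injective (GrAlg.app (F.map m) p) :=
  have := GrAlg.mono_of_injective m hm
  GrAlg.injective_of_mono (F.map m) p

variable {κ : Cardinal.{u}} {F G : GrAlg k ⥤ GrAlg k}

lemma hom_ext (hF : ∀ p, IsSupported κ (F ⋙ GrAlg.degree k p)) {α β : F ⟶ G}
    (h : Functor.whiskerLeft (ι k κ) α = Functor.whiskerLeft (ι k κ) β) : α = β := by
  refine NatTrans.ext (funext fun T => GrAlg.hom_ext fun p x => ?_)
  obtain ⟨b, f, y, rfl⟩ := exists_of_isSupported (hF p) x
  rw [← GrAlg.comp_app, ← GrAlg.comp_app, α.naturality, β.naturality, GrAlg.comp_app,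
    GrAlg.comp_app]
  exact congr_arg (fun g => GrAlg.app (G.map f) p (GrAlg.app g p y)) (NatTrans.congr_app h b)

/-- A natural transformation between the restrictions to small graded algebras extends. -/
lemma exists_extension (hκ : IsLarge k κ) [PreservesFiniteLimits F]
    (hF : ∀ p, IsSupported κ (F ⋙ GrAlg.degree k p)) (α : ι k κ ⋙ F ⟶ ι k κ ⋙ G) :
    ∃ β : F ⟶ G, Functor.whiskerLeft (ι k κ) β = α := by
  have hα {b b' : SmallGrAlg k κ} (g : b ⟶ b') (p : ℤ)
      (y : (F.obj ((ι k κ).obj b)).right.carrier p) :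
      GrAlg.app (α.app b') p (GrAlg.app (F.map ((ι k κ).map g)) p y) =
        GrAlg.app (G.map ((ι k κ).map g)) p (GrAlg.app (α.app b) p y) :=
    congr_arg (fun g => GrAlg.app g p y) (α.naturality g)
  -- The extension must send `F(f)(y)` to `G(f)(α(y))`. For independence of the choice, two
  -- representations are moved to a common small subalgebra of `T`, where they already agree because
  -- `F` preserves monomorphisms.
  have key {T : GrAlg k} {b b' : SmallGrAlg k κ} (f : (ι k κ).obj b ⟶ T)
      (f' : (ι k κ).obj b' ⟶ T) (p : ℤ) (y : (F.obj ((ι k κ).obj b)).right.carrier p)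
      (y' : (F.obj ((ι k κ).obj b')).right.carrier p)
      (h : GrAlg.app (F.map f) p y = GrAlg.app (F.map f') p y') :
      GrAlg.app (G.map f) p (GrAlg.app (α.app b) p y) =
        GrAlg.app (G.map f') p (GrAlg.app (α.app b') p y') := by
    obtain ⟨r, m, g, g', hm, rfl, rfl⟩ := exists_factorization hκ f f'
    simp only [Functor.map_comp, GrAlg.comp_app] at h ⊢
    rw [← hα, ← hα, app_map_injective m hm p h]
  choose b f y hy using fun (T : GrAlg k) (p : ℤ) (x : (F.obj T).right.carrier p) =>
    exists_of_isSupported (hF p) x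
  let φ (T : GrAlg k) (p : ℤ) (x : (F.obj T).right.carrier p) : (G.obj T).right.carrier p :=
    GrAlg.app (G.map (f T p x)) p (GrAlg.app (α.app (b T p x)) p (y T p x))
  have hφ {T : GrAlg k} {b : SmallGrAlg k κ} (f : (ι k κ).obj b ⟶ T) (p : ℤ)
      (y : (F.obj ((ι k κ).obj b)).right.carrier p) :
      φ T p (GrAlg.app (F.map f) p y) = GrAlg.app (G.map f) p (GrAlg.app (α.app b) p y) :=
    key _ _ _ _ _ (hy T p _)
  -- Representing two elements over the same small algebra reduces additivity and multiplicativity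
  -- to those of `α`.
  have common {T : GrAlg k} {p q : ℤ} (x : (F.obj T).right.carrier p)
      (x' : (F.obj T).right.carrier q) :
      ∃ (r : SmallGrAlg k κ) (m : (ι k κ).obj r ⟶ T)
        (y : (F.obj ((ι k κ).obj r)).right.carrier p)
        (y' : (F.obj ((ι k κ).obj r)).right.carrier q),
        GrAlg.app (F.map m) p y = x ∧ GrAlg.app (F.map m) q y' = x' := by
    obtain ⟨r, m, g, g', -, h, h'⟩ := exists_factorization hκ (f T p x) (f T q x')
    refine ⟨r, m, GrAlg.app (F.map ((ι k κ).map g)) p (y T p x),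
      GrAlg.app (F.map ((ι k κ).map g')) q (y T q x'), ?_, ?_⟩
    · rw [← GrAlg.comp_app, ← F.map_comp, h, hy]
    · rw [← GrAlg.comp_app, ← F.map_comp, h', hy]
  have hscalar (T : GrAlg k) (p : ℤ) (c : k.carrier p) :
      φ T p (GrAlg.scalar (F.obj T) p c) = GrAlg.scalar (G.obj T) p c := by
    rw [← GrAlg.app_scalar (F.map (f T p (GrAlg.scalar (F.obj T) p c))), hφ]
    exact (congr_arg _ (GrAlg.app_scalar (α.app _) p c)).trans (GrAlg.app_scalar _ _ _)
  let β (T : GrAlg k) : F.obj T ⟶ G.obj T := Under.homMk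
    { toFun := fun p => AddMonoidHom.mk' (φ T p) fun x x' => by
        obtain ⟨r, m, y, y', rfl, rfl⟩ := common x x'
        rw [← map_add, hφ, hφ, hφ, map_add, map_add]
      map_one := by
        have h (T : GrAlg k) : GrAlg.scalar T 0 k.one = T.right.one := GrCommRing.Hom.map_one _
        have := hscalar T 0 k.one
        rwa [h, h] at this
      map_mul := fun h x x' => by
        obtain ⟨r, m, y, y', rfl, rfl⟩ := common x x'
        change φ _ _ _ = _
        rw [← GrAlg.map_mul, hφ]
        refine (congr_arg _ (GrAlg.map_mul (α.app r) h y y')).trans ?_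
        refine (GrAlg.map_mul _ _ _ _).trans ?_
        rw [← hφ, ← hφ]
        rfl }
    (GrCommRing.hom_ext (hscalar T))
  refine ⟨{ app := β, naturality := fun S T g => GrAlg.hom_ext fun p x => ?_ }, ?_⟩
  · obtain ⟨b, f, y, rfl⟩ := exists_of_isSupported (hF p) x
    change φ T p (GrAlg.app (F.map g) p _) = GrAlg.app (G.map g) p (φ S p _)
    rw [← GrAlg.comp_app, ← F.map_comp, hφ, hφ, G.map_comp, GrAlg.comp_app]
  · refine NatTrans.ext (funext fun b => GrAlg.hom_ext fun p x => ?_)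
    change φ _ p x = _
    have := hφ (𝟙 ((ι k κ).obj b)) p x
    rw [F.map_id, G.map_id] at this
    exact this

end SmallGrAlg

end

/-! ### Left exact subfunctors, solution sets, generated subfunctors -/

section

open Cardinal

/-- Compatible elements of `X` glue uniquely in `Y`; the hypothesis `h` says that the glued element
stays in the subfunctor. -/
lemma preservesLimitsOfShape_walkingCospan_of_injective {A : Type u₁} [Category.{v₁} A]
    [HasPullbacks A] {X Y : A ⥤ Type u} [PreservesLimitsOfShape WalkingCospan Y] (n : X ⟶ Y)
    (hn : ∀ T, Function.Injective (n.app T))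
    (h : ∀ {T T₁ T₂ T₀ : A} {t : T ⟶ T₁} {l : T ⟶ T₂} {r : T₁ ⟶ T₀} {b : T₂ ⟶ T₀},
      IsPullback t l r b → ∀ y : Y.obj T, Y.map t y ∈ Set.range (n.app T₁) →
        Y.map l y ∈ Set.range (n.app T₂) → y ∈ Set.range (n.app T)) :
    PreservesLimitsOfShape WalkingCospan X where
  preservesLimit {K} := by
    have nat {S T : A} (f : S ⟶ T) (x : X.obj S) :
        n.app T (X.map f x) = Y.map f (n.app S x) :=
      ConcreteCategory.congr_hom (C := Type u) (n.naturality f) x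
    have (f : K.obj .left ⟶ K.obj .one) (g : K.obj .right ⟶ K.obj .one) :
        PreservesLimit (cospan f g) X := by
      have sq := IsPullback.of_hasPullback f g
      have sq' := sq.map Y
      refine preservesLimit_of_preserves_limit_cone sq.isLimit
        ((isLimitMapConePullbackConeEquiv X sq.w).symm (IsPullback.isLimit
          ((Types.isPullback_iff _ _ _ _).2 ⟨?_, fun x y hxy => hn _ ?_, fun x y hxy => ?_⟩)))
      · rw [← X.map_comp, sq.w, X.map_comp]
      · exact Types.ext_of_isPullback sq' (by rw [← nat, hxy.1, nat]) (by rw [← nat, hxy.2, nat])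
      · obtain ⟨z, hz₁, hz₂⟩ := Types.exists_of_isPullback sq' (n.app _ x) (n.app _ y)
          (by rw [← nat, hxy, nat])
        obtain ⟨w, rfl⟩ := h sq z ⟨x, hz₁.symm⟩ ⟨y, hz₂.symm⟩
        exact ⟨w, hn _ (by rw [nat, hz₁]), hn _ (by rw [nat, hz₂])⟩
    exact preservesLimit_of_iso_diagram X (diagramIsoCospan K).symm

lemma preservesLimitsOfShape_pempty_of_injective {A : Type u₁} [Category.{v₁} A]
    {X Y : A ⥤ Type u} [PreservesLimitsOfShape (Discrete PEmpty.{1}) Y] (n : X ⟶ Y)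
    (hn : ∀ T, Function.Injective (n.app T)) (h : ∀ T, Nonempty (X.obj T)) :
    PreservesLimitsOfShape (Discrete PEmpty.{1}) X where
  preservesLimit {K} := ⟨fun {c} hc => (Types.isLimit_iff _).2 fun s _ => by
    have hY := (Types.isLimit_iff _).1 ⟨isLimitOfPreserves Y hc⟩ (fun j => j.as.elim)
      (fun {j} => j.as.elim)
    refine ⟨(h c.pt).some, fun j => j.as.elim, fun x _ => hn _ ?_⟩
    exact hY.unique (fun j => j.as.elim) fun j => j.as.elim⟩

/-- A form of the general adjoint functor theorem. -/
theorem hasColimit_of_solutionSet' {C : Type u₁} [Category.{u} C] [HasLimits C] {J : Type u}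
    [SmallCategory J] (D : J ⥤ C) {I : Type u} (X : I → C)
    (h : ∀ c : Cocone D, ∃ (i : I) (s : D ⟶ (Functor.const J).obj (X i)) (g : X i ⟶ c.pt),
      s ≫ (Functor.const J).map g = c.ι) : HasColimit D := by
  -- The weakly initial set consists of all cocones with vertex some `X i`; it is small because
  -- hom-sets are.
  obtain ⟨T, hT⟩ := has_weakly_initial_of_weakly_initial_set_and_hasProducts
    (C := StructuredArrow D (Functor.const J))
    (B := fun i : Σ i, D ⟶ (Functor.const J).obj (X i) => StructuredArrow.mk i.2) fun a => by
      obtain ⟨i, s, g, hs⟩ := h ⟨a.right, a.hom⟩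
      exact ⟨⟨i, s⟩, ⟨StructuredArrow.homMk g hs⟩⟩
  have := hasInitial_of_weakly_initial_and_hasWideEqualizers hT
  rw [hasColimit_iff_hasInitial_cocone]
  exact (Cocone.equivStructuredArrow D).hasInitial_iff.2 this

/-- Natural transformations between functors on all algebras live in a larger universe but form
essentially small sets; the theorem is carried over along the equivalence with `ShrinkHoms`. -/
theorem hasColimit_of_solutionSet {C : Type u₁} [Category.{v₁} C] [LocallySmall.{u} C]
    [HasLimitsOfSize.{u, u} C] {J : Type u} [SmallCategory J] (D : J ⥤ C) {I : Type u} (X : I → C)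
    (h : ∀ c : Cocone D, ∃ (i : I) (s : D ⟶ (Functor.const J).obj (X i)) (g : X i ⟶ c.pt),
      s ≫ (Functor.const J).map g = c.ι) : HasColimit D := by
  let e := ShrinkHoms.equivalence.{u} C
  have : HasLimits (ShrinkHoms.{u₁} C) := Adjunction.has_limits_of_equivalence e.inverse
  have := hasColimit_of_solutionSet' (D ⋙ e.functor) (fun i => e.functor.obj (X i)) fun c => by
    obtain ⟨i, s, g, hs⟩ := h (Functor.mapCoconeInv e.functor c)
    refine ⟨i, Functor.whiskerRight s e.functor ≫ (Functor.constComp J _ _).hom,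
      e.functor.map g ≫ (Functor.mapCoconeMapCoconeInv e.functor c).hom.hom, ?_⟩
    ext j
    have := congr_arg e.functor.map (NatTrans.congr_app hs j)
    have h' := (Functor.mapCoconeMapCoconeInv e.functor c).hom.w j
    simp only [Functor.map_comp, NatTrans.comp_app, Functor.mapCocone_ι_app, Functor.const_map_app] at this h' ⊢
    rw [← h', ← this]
    simp
  exact Adjunction.hasColimit_of_comp_equivalence D e.functor

variable {k : GrCommRing.{u}}

lemma exists_natTrans_lift {F G H : GrAlg k ⥤ GrAlg k} (n : G ⟶ H)
    (hn : ∀ T p, Function.Injective (GrAlg.app (n.app T) p)) (φ : F ⟶ H)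
    (hφ : ∀ T p x, GrAlg.app (φ.app T) p x ∈ Set.range (GrAlg.app (n.app T) p)) :
    ∃ ψ : F ⟶ G, ψ ≫ n = φ := by
  have (T : GrAlg k) := GrAlg.mono_of_injective _ (hn T)
  choose ψ hψ using fun T => GrAlg.exists_lift (n.app T) (hn T) (φ.app T) (hφ T)
  refine ⟨{ app := ψ, naturality := fun S T f => ?_ }, NatTrans.ext (funext hψ)⟩
  rw [← cancel_mono (n.app T), Category.assoc, hψ, φ.naturality, Category.assoc, n.naturality,
    ← Category.assoc, hψ]

open SmallGrAlg

/-- A subfunctor of the restriction of a functor `H` to small graded algebras generates a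
subfunctor of `H`. -/
theorem exists_generated_subfunctor {κ : Cardinal.{u}} (hκ : IsLarge k κ) (H : GrAlg k ⥤ GrAlg k)
    (L : SmallGrAlg k κ ⥤ GrAlg k) (m : L ⟶ ι k κ ⋙ H) :
    ∃ (G : GrAlg k ⥤ GrAlg k) (n : G ⟶ H), (∀ T p, Function.Injective (GrAlg.app (n.app T) p)) ∧
      ∀ T p x, x ∈ Set.range (GrAlg.app (n.app T) p) ↔
        ∃ (b : SmallGrAlg k κ) (f : (ι k κ).obj b ⟶ T) (y : (L.obj b).right.carrier p),
          GrAlg.app (H.map f) p (GrAlg.app (m.app b) p y) = x := by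
  have hm {b b' : SmallGrAlg k κ} (g : b ⟶ b') (p : ℤ) (y : (L.obj b).right.carrier p) :
      GrAlg.app (H.map ((ι k κ).map g)) p (GrAlg.app (m.app b) p y) =
        GrAlg.app (m.app b') p (GrAlg.app (L.map g) p y) :=
    (congr_arg (fun g => GrAlg.app g p y) (m.naturality g)).symm
  let P (T : GrAlg k) (p : ℤ) (x : (H.obj T).right.carrier p) : Prop :=
    ∃ (b : SmallGrAlg k κ) (f : (ι k κ).obj b ⟶ T) (y : (L.obj b).right.carrier p),
      GrAlg.app (H.map f) p (GrAlg.app (m.app b) p y) = x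
  have common {T : GrAlg k} {p q : ℤ} {x : (H.obj T).right.carrier p}
      {x' : (H.obj T).right.carrier q} (hx : P T p x) (hx' : P T q x') :
      ∃ (b : SmallGrAlg k κ) (f : (ι k κ).obj b ⟶ T) (y : (L.obj b).right.carrier p)
        (y' : (L.obj b).right.carrier q), GrAlg.app (H.map f) p (GrAlg.app (m.app b) p y) = x ∧
          GrAlg.app (H.map f) q (GrAlg.app (m.app b) q y') = x' := by
    obtain ⟨b, f, y, rfl⟩ := hx
    obtain ⟨b', f', y', rfl⟩ := hx'
    obtain ⟨r, i, g, g', -, rfl, rfl⟩ := SmallGrAlg.exists_factorization hκ f f'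
    exact ⟨r, i, GrAlg.app (L.map g) p y, GrAlg.app (L.map g') q y',
      by rw [← hm, ← GrAlg.comp_app, ← H.map_comp], by rw [← hm, ← GrAlg.comp_app, ← H.map_comp]⟩
  have hscalar (T : GrAlg k) (p : ℤ) (c : k.carrier p) : P T p (GrAlg.scalar (H.obj T) p c) := by
    -- The initial algebra `k` is itself `κ`-small, so scalars come from the value of `L` there.
    obtain ⟨b, ⟨e⟩⟩ := SmallGrAlg.exists_iso (κ := κ) (T := Under.mk (𝟙 k)) hκ.mk_le
    refine ⟨b, e.hom ≫ Under.mkIdInitial.to T, GrAlg.scalar _ p c, ?_⟩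
    exact (congr_arg _ (GrAlg.app_scalar (m.app b) p c)).trans (GrAlg.app_scalar _ _ _)
  let U (T : GrAlg k) : GrCommRing.Sub (H.obj T).right :=
    { carrier := fun p =>
        { carrier := {x | P T p x}
          zero_mem' := by simpa using hscalar T p 0
          add_mem' := fun hx hy => by
            obtain ⟨b, f, y, y', rfl, rfl⟩ := common hx hy
            exact ⟨b, f, y + y', by simp⟩
          neg_mem' := fun hx => by
            obtain ⟨b, f, y, rfl⟩ := hx
            exact ⟨b, f, -y, by simp⟩ }
      one_mem := by
        have := hscalar T 0 k.one
        rwa [show GrAlg.scalar (H.obj T) 0 k.one = (H.obj T).right.one from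
          GrCommRing.Hom.map_one _] at this
      mul_mem := fun h x y hx hy => by
        obtain ⟨b, f, y, y', rfl, rfl⟩ := common hx hy
        exact ⟨b, f, (L.obj b).right.mul h y y',
          (congr_arg _ (GrAlg.map_mul (m.app b) h y y')).trans (GrAlg.map_mul _ _ _ _)⟩ }
  obtain ⟨G, n, hn, hG⟩ := GrAlg.exists_subfunctor H U hscalar fun {S T} f p x hx => by
    obtain ⟨b, g, y, rfl⟩ := hx
    exact ⟨b, g ≫ f, y, by rw [H.map_comp, GrAlg.comp_app]⟩
  exact ⟨G, n, hn, hG⟩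

end

/-! ### Left exactness of generated subfunctors and existence of colimits -/

section

open Cardinal SmallGrAlg

variable {k : GrCommRing.{u}}

/-- The subfunctor of a left exact functor `H` generated by a subfunctor `L` of its restriction to
small graded algebras is left exact if `L` is closed under unique lifts of elements along jointly
injective pairs of maps. -/
theorem preservesFiniteLimits_of_generated {κ : Cardinal.{u}} (hκ : IsLarge k κ)
    {G H : GrAlg k ⥤ GrAlg k} [PreservesFiniteLimits H] (n : G ⟶ H)
    (hn : ∀ T p, Function.Injective (GrAlg.app (n.app T) p))
    (L : SmallGrAlg k κ ⥤ GrAlg k) (m : L ⟶ ι k κ ⋙ H)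
    (hG : ∀ T p x, x ∈ Set.range (GrAlg.app (n.app T) p) ↔
      ∃ (b : SmallGrAlg k κ) (f : (ι k κ).obj b ⟶ T) (y : (L.obj b).right.carrier p),
        GrAlg.app (H.map f) p (GrAlg.app (m.app b) p y) = x)
    (hL : ∀ {b b₁ b₂ : SmallGrAlg k κ} (f : b ⟶ b₁) (g : b ⟶ b₂) (p : ℤ)
      (x : (H.obj ((ι k κ).obj b)).right.carrier p),
        (∀ y, GrAlg.app (H.map ((ι k κ).map f)) p y = GrAlg.app (H.map ((ι k κ).map f)) p x →
          GrAlg.app (H.map ((ι k κ).map g)) p y = GrAlg.app (H.map ((ι k κ).map g)) p x → y = x) →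
        GrAlg.app (H.map ((ι k κ).map f)) p x ∈ Set.range (GrAlg.app (m.app b₁) p) →
        GrAlg.app (H.map ((ι k κ).map g)) p x ∈ Set.range (GrAlg.app (m.app b₂) p) →
        x ∈ Set.range (GrAlg.app (m.app b) p)) :
    PreservesFiniteLimits G := by
  have hterm (p : ℤ) : PreservesLimitsOfShape (Discrete PEmpty.{1}) (G ⋙ GrAlg.degree k p) :=
    preservesLimitsOfShape_pempty_of_injective (Y := H ⋙ GrAlg.degree k p)
      (Functor.whiskerRight n _) (fun T => hn T p) fun T => ⟨(0 : (G.obj T).right.carrier p)⟩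
  have hpull (p : ℤ) : PreservesLimitsOfShape WalkingCospan (G ⋙ GrAlg.degree k p) := by
    refine preservesLimitsOfShape_walkingCospan_of_injective (Y := H ⋙ GrAlg.degree k p)
      (Functor.whiskerRight n _) (fun T => hn T p) fun {T T₁ T₂ T₀ t l r b} sq y h₁ h₂ => ?_
    obtain ⟨b₁, f₁, y₁, hy₁⟩ := (hG T₁ p _).1 h₁
    obtain ⟨b₂, f₂, y₂, hy₂⟩ := (hG T₂ p _).1 h₂
    -- The two projections of `y` come from small algebras `b₁`, `b₂`, whose maps to `T₀` factor
    -- through a small subalgebra `b₀`. The fibre product of `b₁` and `b₂` over `b₀` is again small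
    -- and maps to `T`.
    obtain ⟨b₀, i, g₁, g₂, hi, hg₁, hg₂⟩ := SmallGrAlg.exists_factorization hκ (f₁ ≫ r) (f₂ ≫ b)
    have := isClosedUnderLimitsOfShape_sizeLE (k := k) hκ.1 WalkingCospan
    obtain ⟨b', ⟨e⟩⟩ := SmallGrAlg.exists_iso (κ := κ)
      (T := pullback ((ι k κ).map g₁) ((ι k κ).map g₂)) ((sizeLE k κ).prop_limit _ fun
        | .one => sizeLE_obj b₀
        | .left => sizeLE_obj b₁
        | .right => sizeLE_obj b₂)
    have sq₁ := (IsPullback.of_hasPullback ((ι k κ).map g₁) ((ι k κ).map g₂)).of_iso e.symm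
      (Iso.refl _) (Iso.refl _) (Iso.refl _) (fst' := e.hom ≫ pullback.fst _ _)
      (snd' := e.hom ≫ pullback.snd _ _) (f' := (ι k κ).map g₁) (g' := (ι k κ).map g₂)
      (by simp) (by simp) (by simp) (by simp)
    obtain ⟨q₁, hq₁⟩ := (ι k κ).map_surjective (e.hom ≫ pullback.fst _ _)
    obtain ⟨q₂, hq₂⟩ := (ι k κ).map_surjective (e.hom ≫ pullback.snd _ _)
    rw [← hq₁, ← hq₂] at sq₁
    have sqH := sq.map (H ⋙ GrAlg.degree k p)
    have sqH₁ := sq₁.map (H ⋙ GrAlg.degree k p)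
    have hw : ((ι k κ).map q₁ ≫ f₁) ≫ r = ((ι k κ).map q₂ ≫ f₂) ≫ b := by
      rw [Category.assoc, Category.assoc, ← hg₁, ← hg₂, ← Category.assoc, sq₁.w, Category.assoc]
    have hcomp {S T U : GrAlg k} (f : S ⟶ T) (g : T ⟶ U) (x : (H.obj S).right.carrier p) :
        GrAlg.app (H.map (f ≫ g)) p x = GrAlg.app (H.map g) p (GrAlg.app (H.map f) p x) := by
      rw [H.map_comp, GrAlg.comp_app]
    -- `y₁` and `y₂` agree over `b₀` since they do over `T₀`, so they glue to `z` in `H` of the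
    -- small fibre product; by `hL` this unique lift belongs to `L`, and its image over `T` is `y`.
    obtain ⟨z, hz₁, hz₂⟩ := Types.exists_of_isPullback sqH₁ (GrAlg.app (m.app b₁) p y₁)
      (GrAlg.app (m.app b₂) p y₂) (by
        apply app_map_injective (F := H) i hi p
        change GrAlg.app (H.map i) p (GrAlg.app (H.map ((ι k κ).map g₁)) p _) =
          GrAlg.app (H.map i) p (GrAlg.app (H.map ((ι k κ).map g₂)) p _)
        rw [← hcomp, ← hcomp, hg₁, hg₂, hcomp, hcomp, hy₁, hy₂]
        exact ConcreteCategory.congr_hom (C := Type u) sqH.w y)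
    obtain ⟨w, hw'⟩ := hL q₁ q₂ p z (fun z' h h' => Types.ext_of_isPullback sqH₁ h h')
      ⟨y₁, hz₁.symm⟩ ⟨y₂, hz₂.symm⟩
    refine (hG T p y).2 ⟨b', sq.lift _ _ hw, w, ?_⟩
    refine Types.ext_of_isPullback sqH ?_ ?_
    · rw [hw']
      refine (hcomp _ _ _).symm.trans ?_
      refine (congr_arg (fun g => GrAlg.app (H.map g) p z) (sq.lift_fst _ _ hw)).trans ?_
      exact (hcomp _ _ _).trans ((congr_arg _ hz₁).trans hy₁)
    · rw [hw']
      refine (hcomp _ _ _).symm.trans ?_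
      refine (congr_arg (fun g => GrAlg.app (H.map g) p z) (sq.lift_snd _ _ hw)).trans ?_
      exact (hcomp _ _ _).trans ((congr_arg _ hz₂).trans hy₂)
  exact GrAlg.preservesFiniteLimits_of_degree G fun p =>
    preservesFiniteLimits_of_preservesTerminal_and_pullbacks _

/-- A transformation out of `F` is determined on the small algebras supporting `F`, and these have a
small model. -/
instance : LocallySmall.{u} (FAlgSch k) where
  hom_small F G := by
    obtain ⟨κ, hκ⟩ := F.property.exists_isSupported
    have : Small.{u} (ι k κ ⋙ F.obj ⟶ ι k κ ⋙ G.obj) := inferInstance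
    exact small_of_injective (f := fun α : F ⟶ G => Functor.whiskerLeft (ι k κ) α.hom)
      fun α β h => ObjectProperty.hom_ext _ (SmallGrAlg.hom_ext hκ h)

lemma nonempty_iso_of_restriction {κ : Cardinal.{u}} (hκ : IsLarge k κ) {F G : FAlgSch k}
    (hF : ∀ p, IsSupported κ (F.obj ⋙ GrAlg.degree k p))
    (hG : ∀ p, IsSupported κ (G.obj ⋙ GrAlg.degree k p)) (e : ι k κ ⋙ F.obj ≅ ι k κ ⋙ G.obj) :
    Nonempty (F ≅ G) := by
  have := F.property.preservesFiniteLimits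
  have := G.property.preservesFiniteLimits
  obtain ⟨α, hα⟩ := exists_extension hκ hF e.hom
  obtain ⟨β, hβ⟩ := exists_extension hκ hG e.inv
  refine ⟨(isFormalAlgebraScheme k).fullyFaithfulι.preimageIso ⟨α, β, SmallGrAlg.hom_ext hF ?_,
    SmallGrAlg.hom_ext hG ?_⟩⟩
  · rw [Functor.whiskerLeft_comp, hα, hβ, e.hom_inv_id]
    rfl
  · rw [Functor.whiskerLeft_comp, hα, hβ, e.inv_hom_id]
    rfl

instance {J : Type u} [SmallCategory J] (D : J ⥤ FAlgSch k) : HasColimit D := by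
  choose κ₀ hκ₀ using fun j => (D.obj j).property.exists_isSupported
  obtain ⟨κ, hle, hκ⟩ := exists_isLarge k (sum κ₀)
  have hD (j : J) (p : ℤ) : IsSupported κ ((D.obj j).obj ⋙ GrAlg.degree k p) :=
    (hκ₀ j p).mono ((le_sum κ₀ j).trans hle)
  -- `μ` depends only on `D` and `κ`, not on the cocone: it bounds the values of `D` on small
  -- algebras and the number of indices, small algebras and closure operations.
  obtain ⟨μ₀, hμ₀⟩ := exists_sizeLE fun a : J × SmallGrAlg k κ =>
    (D.obj a.1).obj.obj ((ι k κ).obj a.2)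
  obtain ⟨μ, hle', hμ⟩ := exists_isLarge k
    (max μ₀ (max #J (max #(SmallGrAlg k κ) #(SubfunctorOp (SmallGrAlg k κ)))))
  simp only [max_le_iff] at hle'
  obtain ⟨hle₁, hle₂, hle₃, hle₄⟩ := hle'
  let P (L : SmallGrAlg k κ ⥤ SmallGrAlg k μ) (F : FAlgSch k) : Prop :=
    (∀ p, IsSupported κ (F.obj ⋙ GrAlg.degree k p)) ∧ Nonempty (ι k κ ⋙ F.obj ≅ L ⋙ ι k μ)
  -- The solution set has one chosen formal algebra scheme for each functor from `κ`-small to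
  -- `μ`-small algebras that arises as a restriction.
  refine hasColimit_of_solutionSet D (I := {L // ∃ F, P L F}) (fun L => L.2.choose) fun c => ?_
  have := c.pt.property.preservesFiniteLimits
  obtain ⟨L, m, hm, hL, hS, hcl⟩ := exists_small_subfunctor (ι k κ ⋙ c.pt.obj) hμ.1 hμ.2 hle₃ hle₄
    (fun b p => Set.range fun a : Σ j, ((D.obj j).obj.obj ((ι k κ).obj b)).right.carrier p =>
      GrAlg.app ((c.ι.app a.1).hom.app ((ι k κ).obj b)) p a.2) fun b p =>
    mk_range_le.trans ((mk_sigma_le hμ.1 (by simpa using hle₂)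
      fun j => (hμ₀ (j, b) p).trans hle₁).trans_eq (lift_id μ))
  obtain ⟨G, n, hn, hG⟩ := exists_generated_subfunctor hκ c.pt.obj L m
  have := preservesFiniteLimits_of_generated hκ n hn L m hG hcl
  have nat {F H : GrAlg k ⥤ GrAlg k} (α : F ⟶ H) {S T : GrAlg k} (f : S ⟶ T) (p : ℤ)
      (x : (F.obj S).right.carrier p) :
      GrAlg.app (H.map f) p (GrAlg.app (α.app S) p x) =
        GrAlg.app (α.app T) p (GrAlg.app (F.map f) p x) :=
    (congr_arg (fun g => GrAlg.app g p x) (α.naturality f)).symm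
  have hGsupp (p : ℤ) : IsSupported κ (G ⋙ GrAlg.degree k p) := fun T x => by
    obtain ⟨b, f, y, hy⟩ := (hG T p _).1 ⟨x, rfl⟩
    obtain ⟨z, hz⟩ := (hG ((ι k κ).obj b) p (GrAlg.app (m.app b) p y)).2
      ⟨b, 𝟙 _, y, congr_arg (fun g => GrAlg.app g p (GrAlg.app (m.app b) p y))
        (c.pt.obj.map_id _)⟩
    refine ⟨_, f, z, sizeLE_obj b, hn T p ?_⟩
    rw [← hy, ← hz]
    exact (nat n f p z).symm
  let G' : FAlgSch k := ⟨G, fun p => (isFormalScheme_iff _).2 ⟨inferInstanceAs (PreservesFiniteLimits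
    (G ⋙ GrAlg.degree k p)), κ, hGsupp p⟩⟩
  -- On a `κ`-small algebra `G` contains nothing beyond `L`, because `ι` is full and `L` is already
  -- a functor.
  have hsize (b : SmallGrAlg k κ) : sizeLE k μ (G.obj ((ι k κ).obj b)) := fun p => by
    refine (mk_range_eq _ (hn ((ι k κ).obj b) p)).symm.trans_le ((mk_le_mk_of_subset
      (t := Set.range (GrAlg.app (m.app b) p)) fun x hx => ?_).trans (mk_range_le.trans (hL b p)))
    obtain ⟨b', f, y, rfl⟩ := (hG _ p x).1 hx
    obtain ⟨g, rfl⟩ := (ι k κ).map_surjective f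
    exact ⟨GrAlg.app (L.map g) p y, congr_arg (fun g => GrAlg.app g p y) (m.naturality g)⟩
  have hP : P ((sizeLE k μ).lift (ι k κ ⋙ G) hsize ⋙ (equivSmallModel _).functor) G' :=
    ⟨hGsupp, ⟨Functor.isoWhiskerRight (Functor.isoWhiskerLeft ((sizeLE k μ).lift (ι k κ ⋙ G) hsize)
      (equivSmallModel.{u} (sizeLE k μ).FullSubcategory).unitIso) (sizeLE k μ).ι⟩⟩
  let i : {L // ∃ F, P L F} := ⟨_, G', hP⟩
  -- `G` and the chosen scheme have isomorphic restrictions and support bounded by `κ`, so they are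
  -- isomorphic.
  obtain ⟨e⟩ := nonempty_iso_of_restriction hκ hGsupp i.2.choose_spec.1
    (hP.2.some ≪≫ i.2.choose_spec.2.some.symm)
  choose ψ hψ using fun j => exists_natTrans_lift n hn (c.ι.app j).hom fun T p x => by
    obtain ⟨b, f, y, rfl⟩ := exists_of_isSupported (hD j p) x
    obtain ⟨z, hz⟩ := hS b p ⟨⟨j, y⟩, rfl⟩
    refine (hG T p _).2 ⟨b, f, z, (congr_arg _ hz).trans (nat _ f p y)⟩
  have (T : GrAlg k) := GrAlg.mono_of_injective _ (hn T)
  have := NatTrans.mono_of_mono_app n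
  refine ⟨i, { app := fun j => ObjectProperty.homMk (ψ j) ≫ e.hom, naturality := fun j j' f => ?_ },
    e.inv ≫ ObjectProperty.homMk n, ?_⟩
  · have : (D.map f).hom ≫ ψ j' = ψ j := by
      rw [← cancel_mono n, Category.assoc, hψ, hψ]
      exact congr_arg (fun g => g.hom) (c.w f)
    refine Eq.trans ?_ (Category.comp_id _).symm
    rw [← Category.assoc]
    exact congr_arg (fun g => ObjectProperty.homMk g ≫ e.hom) this
  · refine NatTrans.ext (funext fun j => ?_)
    refine (Category.assoc _ _ _).trans ?_
    rw [Functor.const_map_app, e.hom_inv_id_assoc]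
    exact ObjectProperty.hom_ext _ (hψ j)

instance : HasColimitsOfSize.{u, u} (FAlgSch k) where
  has_colimits_of_shape _ _ := ⟨inferInstance⟩

end

end FormalPlethory


theorem theorem1p1 (k : FormalPlethory.GrCommRing.{u}) :
    HasLimitsOfSize.{u, u} (FormalPlethory.FAlgSch k) ∧
    HasColimitsOfSize.{u, u} (FormalPlethory.FAlgSch k) ∧
    ∃ (_ : MonoidalCategory (FormalPlethory.FAlgSch k))
      (_ : FormalPlethory.TensorIsComposition (FormalPlethory.isFormalAlgebraScheme k)),
      (∃ _ : MonoidalRightAction (FormalPlethory.FAlgSch k) (FormalPlethory.FSch k),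
        Nonempty (FormalPlethory.ActionIsComposition
          (FormalPlethory.isFormalAlgebraScheme k) (FormalPlethory.isFormalScheme k))) ∧
      (∃ _ : MonoidalRightAction (FormalPlethory.FAlgSch k) (FormalPlethory.GrFSch k),
        Nonempty (FormalPlethory.ActionIsComposition
          (FormalPlethory.isFormalAlgebraScheme k) (FormalPlethory.isGradedFormalScheme k))) :=
  have hid := FormalPlethory.isFormalAlgebraScheme_id (k := k)
  have hcomp {F G : FormalPlethory.GrAlg k ⥤ FormalPlethory.GrAlg k}
      (hF : FormalPlethory.isFormalAlgebraScheme k F)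
      (hG : FormalPlethory.isFormalAlgebraScheme k G) :
      FormalPlethory.isFormalAlgebraScheme k (F ⋙ G) :=
    FormalPlethory.isFormalAlgebraScheme_comp hF hG
  have hX {F : FormalPlethory.GrAlg k ⥤ FormalPlethory.GrAlg k}
      {X : FormalPlethory.GrAlg k ⥤ Type u} (hF : FormalPlethory.isFormalAlgebraScheme k F)
      (hX : FormalPlethory.isFormalScheme k X) : FormalPlethory.isFormalScheme k (F ⋙ X) :=
    FormalPlethory.isFormalScheme_comp hF hX
  have hX' {F : FormalPlethory.GrAlg k ⥤ FormalPlethory.GrAlg k}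
      {X : FormalPlethory.GrAlg k ⥤ (ℤ → Type u)} (hF : FormalPlethory.isFormalAlgebraScheme k F)
      (hX : FormalPlethory.isGradedFormalScheme k X) :
      FormalPlethory.isGradedFormalScheme k (F ⋙ X) :=
    FormalPlethory.isGradedFormalScheme_comp hF hX
  ⟨inferInstance, inferInstance, FormalPlethory.compositionMonoidalCategory _ hid hcomp,
    FormalPlethory.compositionTensorIsComposition _ hid hcomp,
    ⟨FormalPlethory.compositionRightAction _ hid hcomp _ hX,
      ⟨FormalPlethory.compositionActionIsComposition _ hid hcomp _ hX⟩⟩,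
    ⟨FormalPlethory.compositionRightAction _ hid hcomp _ hX',
      ⟨FormalPlethory.compositionActionIsComposition _ hid hcomp _ hX'⟩⟩⟩
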